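/- Let $\mathbb N=\{0,1,2,\dots\}$ and let $p(n)$ be the $n$-th prime ($p(1)=2$). All expressions below are integer-valued, with arguments in $\mathbb N$ (or integer-valued expressions in such arguments). **Building blocks.** $$E_/(x,w;y_1,y_2;z)=(x-wz-y_1)^2+(y_1+y_2+1-w)^2,$$ $$E_{\bmod}(x,w;y_1,y_2;z)=(x-wy_1-z)^2+(z+y_2+1-w)^2,$$ $$E_{\mid}(x;y;w)=(x-wy)^2,\qquad E_{\nmid}(x;y_1,y_2,y_3;w)=(x-wy_1-y_2-1)^2+(y_2+y_3+2-w)^2,$$ $$E_\nu(x;y_1,\dots,y_4;z)=E_\nmid(x;y_1,y_2,y_3;2^{z+1})+E_\mid(x;y_4;2^z),$$ $$\begin{aligned}E_{\mathrm{bin}}(x,w;y_1,\dots,y_7;z)={}&(y_1-(2x^3+8x^2+2xw+12x+4w+8))^2+(y_2-(2x^2+8x+8))^2\\&+E_/(2^{y_1},2^{y_2}-2^{2x+4}-1;y_4,y_5;y_3)+E_{\bmod}(y_3,2^{2x+4};y_6,y_7;z),\end{aligned}$$ $$\begin{aligned}E_!(x;y_1,\dots,y_{13};z)={}&(y_1-x^2)^2+(y_2-2^{3y_1})^2+(y_3-xy_1)^2\\&+E_{\mathrm{bin}}(y_2,x;y_5,\dots,y_{11};y_4)+E_/(2^{3y_3},y_4;y_{12},y_{13};z),\end{aligned}$$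 $$E_{\mathrm{HW}}(x;y_1,\dots,y_{12};z)=E_{\mathrm{bin}}(2x,x;y_2,\dots,y_8;y_1)+E_\nu(y_1;y_9,\dots,y_{12};z).$$ **The term $M$.** Let $G_r(q,t)=\sum_{j=0}^{t-1}j^rq^j$ (with $0^0=1$). For $k\in\mathbb N$ put $t=k+1$, $u=k+5$, $q_1=2^{2u}$, $q_2=2^{2ut}$, $g_{i,j}=G_i(q_j,t)$, and $$M(k)=\frac{2^u(q_2^t-1)}{2^u+1}-(2^u-1)\left(g_{4,1}g_{0,2}-2g_{2,1}g_{0,2}-2k\,g_{2,1}g_{1,2}+k^2g_{0,1}g_{2,2}+2k\,g_{0,1}g_{1,2}\right)\in\mathbb Z .$$ **The relation $m=M(4f_1)$ with $9$ unknowns.** Given $f_1,f_2,f_3$, write $t_1=4f_1$, $U=2^{4f_1+5}$, and $$q_1=2^{8f_1+10},\quad q_2=2^{32f_2+48f_1+10},\quad R_1=2^{32f_2+40f_1},\quad R_2=2^{128f_3+192f_2+40f_1},\quad S_1=q_2,\quad S_2=2^{128f_3+224f_2+88f_1+10}$$ (for $f_2=f_1^2$, $f_3=f_1^3$, $t=4f_1+1$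 one has $R_j=q_j^{t-1}$, $S_j=q_j^{t}$). For a further argument $s$ (to be $4f_1+1$) let, for $j=1,2$, $$\begin{aligned}N_{0,j}&=S_j-1,\qquad N_{1,j}(s)=q_j(t_1S_j-sR_j+1),\\ N_{2,j}(s)&=q_j\left(t_1^2R_jq_j^2-(2t_1^2+2t_1-1)S_j+s^2R_j-q_j-1\right),\\ N_{4,j}(s)&=q_j\big(t_1^4R_jq_j^4+(-4t_1^4-4t_1^3+6t_1^2-4t_1+1)R_jq_j^3+(6t_1^4+12t_1^3-6t_1^2-12t_1+11)R_jq_j^2\\&\qquad+(-4t_1^4-12t_1^3-6t_1^2+12t_1+11)S_j+s^4R_j-q_j^3-11q_j^2-11q_j-1\big).\end{aligned}$$ With nine unknowns $q_{1,1},q_{2,1},g_{0,1},g_{2,1},g_{4,1},g_{0,2},g_{1,2},g_{2,2},C$ put $$\begin{aligned}E_{M4}(f_1,f_2,f_3,f_4;&\,q_{1,1},q_{2,1},g_{0,1},g_{2,1},g_{4,1},g_{0,2},g_{1,2},g_{2,2},C;\,m)\\={}&(q_{1,1}-q_1+1)^2+(q_{2,1}-q_2+1)^2+(g_{0,1}q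_{1,1}-N_{0,1})^2+(g_{0,2}q_{2,1}-N_{0,2})^2\\&+(g_{1,2}q_{2,1}^2-N_{1,2}(f_4))^2+(g_{2,1}q_{1,1}^3-N_{2,1}(f_4))^2+(g_{2,2}q_{2,1}^3-N_{2,2}(f_4))^2\\&+(g_{4,1}q_{1,1}^5-N_{4,1}(f_4))^2+(C(U+1)-U(S_2-1))^2\\&+\Big(m-\big(C+(1-U)(g_{4,1}g_{0,2}-2g_{2,1}g_{0,2}-8f_1g_{2,1}g_{1,2}+16f_1^2g_{0,1}g_{2,2}+8f_1g_{0,1}g_{1,2})\big)\Big)^2.\end{aligned}$$ **The $42$-variable equation.** For unknowns $\vec x=(a,f_1,f_2,f_3,f_4,m,b,d)\in\mathbb N^8$ and $\vec y\in\mathbb N^{34}$ let $$\begin{aligned}\hat F(n,\vec x,\vec y)={}&E_!(a;y_1,\dots,y_{13};f_1)+(f_2-f_1^2)^2+(f_3-f_1f_2)^2+(f_4-4f_1-1)^2\\&+E_{M4}(f_1,f_2,f_3,f_4;y_{14},\dots,y_{22};m)+E_{\mathrm{HW}}(m;y_{23},\dots,y_{34};b)\\&+\left(b+(4f_1+5)(-f_4^2+d-2^n)\right)^2.\end{aligned}$$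 **The $32$-variable equation.** Call a pair $(L,D)$ of functions $\mathbb N^3\to\mathbb Z$ a *rational form* of $M(4f)$ if for all $f\in\mathbb N$ one has $D(f,f^2,f^3)\ne0$ and $M(4f)\,D(f,f^2,f^3)=L(f,f^2,f^3)$. For such a pair, unknowns $\vec x=(a,f_1,f_2,f_3,m,b,d)\in\mathbb N^7$ and $\vec y\in\mathbb N^{25}$, let $$\begin{aligned}F_{L,D}(n,\vec x,\vec y)={}&E_!(a;y_1,\dots,y_{13};f_1)+(f_2-f_1^2)^2+(f_3-f_1f_2)^2+\left(m\,D(f_1,f_2,f_3)-L(f_1,f_2,f_3)\right)^2\\&+E_{\mathrm{HW}}(m;y_{14},\dots,y_{25};b)+\left(b+(4f_1+5)(-(4f_1+1)^2+d-2^n)\right)^2.\end{aligned}$$ An explicit choice is, with $N_{i,j}=N_{i,j}(4f_1+1)$, $r_1=q_1-1$, $r_2=q_2-1$, $$D_0=(U+1)\,r_1^5r_2^3,$$ $$\begin{aligned}L_0={}&U(S_2-1)r_1^5r_2^3+(U+1)(1-U)\big(N_{4,1}N_{0,2}r_2^2-2N_{2,1}N_{0,2}r_1^2r_2^2\\&-8f_1N_{2,1}N_{1,2}r_1^2r_2+16f_1^2N_{0,1}N_{2,2}r_1^4+8f_1N_{0,1}N_{1,2}r_1^4r_2\big).\end{aligned}$$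 **Theorem.** 1. For every $n\ge1$, the number of solutions $(\vec x,\vec y)\in\mathbb N^{42}$ of the exponential Diophantine equation $\hat F(n,\vec x,\vec y)=0$ is exactly $p(n)$. 2. $(L_0,D_0)$ is a rational form of $M(4f)$, and for every $n\ge1$ the number of solutions $(\vec x,\vec y)\in\mathbb N^{32}$ of the exponential Diophantine equation $F_{L_0,D_0}(n,\vec x,\vec y)=0$ is exactly $p(n)$. More generally, for every rational form $(L,D)$ of $M(4f)$ and every $n\ge1$, the number of solutions in $\mathbb N^{32}$ of $F_{L,D}(n,\vec x,\vec y)=0$ is exactly $p(n)$. -/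

import Mathlib

namespace NthPrimeEq

/-! Single-fold exponential Diophantine relations. Every relation is an integer-valued expression,
a sum of squares, in natural number arguments; the arguments named `y`, `y₁`, `y₂`, … are its
existentially quantified variables. -/

/-- `z = ⌊x / w⌋`. -/
def EDiv (x w : ℤ) (y₁ y₂ : ℕ) (z : ℤ) : ℤ :=
  (x - w * z - y₁) ^ 2 + (y₁ + y₂ + 1 - w) ^ 2

/-- `z = x mod w`. -/
def EMod (x w : ℤ) (y₁ y₂ : ℕ) (z : ℤ) : ℤ :=
  (x - w * y₁ - z) ^ 2 + (z + y₂ + 1 - w) ^ 2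

/-- `w ∣ x`. -/
def EDvd (x : ℤ) (y : ℕ) (w : ℤ) : ℤ :=
  (x - w * y) ^ 2

/-- `w ∤ x`. -/
def ENotDvd (x : ℤ) (y₁ y₂ y₃ : ℕ) (w : ℤ) : ℤ :=
  (x - w * y₁ - y₂ - 1) ^ 2 + (y₂ + y₃ + 2 - w) ^ 2

/-- `z` is the exponent of `2` in `x`. -/
def ENu (x : ℕ) (y₁ y₂ y₃ y₄ : ℕ) (z : ℕ) : ℤ :=
  ENotDvd x y₁ y₂ y₃ (2 ^ (z + 1)) + EDvd x y₄ (2 ^ z)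

/-- `z = x.choose w`. -/
def EBinom (x w : ℕ) (y₁ y₂ y₃ y₄ y₅ y₆ y₇ : ℕ) (z : ℕ) : ℤ :=
  ((y₁ : ℤ) - (2 * x ^ 3 + 8 * x ^ 2 + 2 * x * w + 12 * x + 4 * w + 8)) ^ 2
    + ((y₂ : ℤ) - (2 * x ^ 2 + 8 * x + 8)) ^ 2
    + EDiv (2 ^ y₁) (2 ^ y₂ - 2 ^ (2 * x + 4) - 1) y₄ y₅ y₃
    + EMod y₃ (2 ^ (2 * x + 4)) y₆ y₇ z

/-- `z = x!`. -/
def EFact (x : ℕ) (y₁ y₂ y₃ y₄ y₅ y₆ y₇ y₈ y₉ y₁₀ y₁₁ y₁₂ y₁₃ : ℕ) (z : ℕ) : ℤ :=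
  ((y₁ : ℤ) - x ^ 2) ^ 2 + ((y₂ : ℤ) - 2 ^ (3 * y₁)) ^ 2 + ((y₃ : ℤ) - x * y₁) ^ 2
    + EBinom y₂ x y₅ y₆ y₇ y₈ y₉ y₁₀ y₁₁ y₄
    + EDiv (2 ^ (3 * y₃)) y₄ y₁₂ y₁₃ z

/-- `z` is the Hamming weight of `x`. -/
def EHW (x : ℕ) (y₁ y₂ y₃ y₄ y₅ y₆ y₇ y₈ y₉ y₁₀ y₁₁ y₁₂ : ℕ) (z : ℕ) : ℤ :=
  EBinom (2 * x) x y₂ y₃ y₄ y₅ y₆ y₇ y₈ y₁ + ENu y₁ y₉ y₁₀ y₁₁ y₁₂ z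

/-! The term `M`. -/

/-- The generalized geometric progression of the `r`-th kind, `G_r(q, t) = ∑_{j<t} j^r q^j`. -/
def G (r : ℕ) (q : ℤ) (t : ℕ) : ℤ :=
  ∑ j ∈ Finset.range t, (j : ℤ) ^ r * q ^ j

/-- Contribution of a monomial `c * x₁ ^ r₁ * x₂ ^ r₂` in the hypercube method
in dimension two. -/
def termA (c : ℤ) (r₁ r₂ t u : ℕ) : ℤ :=
  -(2 ^ u - 1) * c * (G r₁ (2 ^ (2 * u)) t * G r₂ (2 ^ (2 * u * t)) t)

/-- Contribution of a constant `c` in the hypercube method in dimension two; the division by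
`2 ^ u + 1` is exact, because `2 ^ u + 1` divides `2 ^ (2 * u) - 1`. -/
def termC (c : ℤ) (t u : ℕ) : ℤ :=
  (2 ^ u - c + 1) * (2 ^ (2 * u * t ^ 2) - 1) / (2 ^ u + 1)

/-- `M(n)`: the hypercube encoding of `(x₁ ^ 2 - n * x₂ - 1) ^ 2` with `t = n + 1`,
`u = n + 5`. -/
def M (n : ℕ) : ℤ :=
  termC 1 (n + 1) (n + 5)
    + termA 1 4 0 (n + 1) (n + 5)
    + termA (-2) 2 0 (n + 1) (n + 5)
    + termA (-2 * n) 2 1 (n + 1) (n + 5)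
    + termA (n ^ 2) 0 2 (n + 1) (n + 5)
    + termA (2 * n) 0 1 (n + 1) (n + 5)

/-! Numerators of the closed forms of `G_r(q, t)`, whose denominators are `(q - 1) ^ (r + 1)`.
The arguments are `t₁ = t - 1`, `t`, `q`, the power `Q₁ = q ^ (t - 1)`, and the power
`Q = q ^ t`. -/

def num0 (Q : ℤ) : ℤ := Q - 1

def num1 (t₁ t q Q₁ Q : ℤ) : ℤ := q * (t₁ * Q - t * Q₁ + 1)

def num2 (t₁ t q Q₁ Q : ℤ) : ℤ :=
  q * (t₁ ^ 2 * (Q₁ * q ^ 2) - (2 * t₁ ^ 2 + 2 * t₁ - 1) * Q + t ^ 2 * Q₁ - q - 1)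

def num4 (t₁ t q Q₁ Q : ℤ) : ℤ :=
  q * (t₁ ^ 4 * (Q₁ * q ^ 4)
    + (-4 * t₁ ^ 4 - 4 * t₁ ^ 3 + 6 * t₁ ^ 2 - 4 * t₁ + 1) * (Q₁ * q ^ 3)
    + (6 * t₁ ^ 4 + 12 * t₁ ^ 3 - 6 * t₁ ^ 2 - 12 * t₁ + 11) * (Q₁ * q ^ 2)
    + (-4 * t₁ ^ 4 - 12 * t₁ ^ 3 - 6 * t₁ ^ 2 + 12 * t₁ + 11) * Q
    + t ^ 4 * Q₁ - q ^ 3 - 11 * q ^ 2 - 11 * q - 1)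

/-! With `t = 4 f₁ + 1` and `u = 4 f₁ + 5`, the powers of `q₁ = 2 ^ (2 u)` and
`q₂ = 2 ^ (2 t u) = q₁ ^ t` that occur are written with exponents linear in `f₁`, `f₂`, `f₃`,
where `f₂` and `f₃` stand for `f₁ ^ 2` and `f₁ ^ 3`. -/

/-- `2 ^ u`. -/
def powU (f₁ : ℕ) : ℤ := 2 ^ (4 * f₁ + 5)

/-- `q₁ = 2 ^ (2 u)`. -/
def q1 (f₁ : ℕ) : ℤ := 2 ^ (8 * f₁ + 10)

/-- `q₁ ^ (t - 1)`. -/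
def q1t1 (f₁ f₂ : ℕ) : ℤ := 2 ^ (32 * f₂ + 40 * f₁)

/-- `q₂ = q₁ ^ t`. -/
def q2 (f₁ f₂ : ℕ) : ℤ := 2 ^ (32 * f₂ + 48 * f₁ + 10)

/-- `q₂ ^ (t - 1)`. -/
def q2t1 (f₁ f₂ f₃ : ℕ) : ℤ := 2 ^ (128 * f₃ + 192 * f₂ + 40 * f₁)

/-- `q₂ ^ t`. -/
def q2t (f₁ f₂ f₃ : ℕ) : ℤ := 2 ^ (128 * f₃ + 224 * f₂ + 88 * f₁ + 10)

/-- `m = M (4 f₁)`, when `f₂ = f₁ ^ 2`, `f₃ = f₁ ^ 3`, `f₄ = 4 f₁ + 1`. The nine quantified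
variables `q₁₁`, …, `c` stand for `q₁ - 1`, `q₂ - 1`, `g_{i,j} = G_i(q_j, t)`, and the constant
contribution. -/
def EM4 (f₁ f₂ f₃ f₄ : ℕ) (q₁₁ q₂₁ g₀₁ g₂₁ g₄₁ g₀₂ g₁₂ g₂₂ c : ℕ) (m : ℕ) : ℤ :=
  ((q₁₁ : ℤ) - q1 f₁ + 1) ^ 2
    + ((q₂₁ : ℤ) - q2 f₁ f₂ + 1) ^ 2
    + ((g₀₁ : ℤ) * q₁₁ - num0 (q2 f₁ f₂)) ^ 2
    + ((g₀₂ : ℤ) * q₂₁ - num0 (q2t f₁ f₂ f₃)) ^ 2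
    + ((g₁₂ : ℤ) * q₂₁ ^ 2
        - num1 (4 * f₁) f₄ (q2 f₁ f₂) (q2t1 f₁ f₂ f₃) (q2t f₁ f₂ f₃)) ^ 2
    + ((g₂₁ : ℤ) * q₁₁ ^ 3
        - num2 (4 * f₁) f₄ (q1 f₁) (q1t1 f₁ f₂) (q2 f₁ f₂)) ^ 2
    + ((g₂₂ : ℤ) * q₂₁ ^ 3
        - num2 (4 * f₁) f₄ (q2 f₁ f₂) (q2t1 f₁ f₂ f₃) (q2t f₁ f₂ f₃)) ^ 2
    + ((g₄₁ : ℤ) * q₁₁ ^ 5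
        - num4 (4 * f₁) f₄ (q1 f₁) (q1t1 f₁ f₂) (q2 f₁ f₂)) ^ 2
    + ((c : ℤ) * (powU f₁ + 1) - powU f₁ * (q2t f₁ f₂ f₃ - 1)) ^ 2
    + ((m : ℤ) - (c
        + (1 - powU f₁) * g₄₁ * g₀₂
        - 2 * ((1 - powU f₁) * g₂₁ * g₀₂)
        - 2 * (4 * f₁) * ((1 - powU f₁) * g₂₁ * g₁₂)
        + (4 * f₁) ^ 2 * ((1 - powU f₁) * g₀₁ * g₂₂)
        + 2 * (4 * f₁) * ((1 - powU f₁) * g₀₁ * g₁₂))) ^ 2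

/-- The left-hand side of the exponential Diophantine equation in `42` unknowns
`v = (a, f₁, f₂, f₃, f₄, m, b, d, y₁, …, y₃₄)`. -/
def Fhat (n : ℕ) (v : Fin 42 → ℕ) : ℤ :=
  let a := v 0
  let f₁ := v 1
  let f₂ := v 2
  let f₃ := v 3
  let f₄ := v 4
  let m := v 5
  let b := v 6
  let d := v 7
  EFact a (v 8) (v 9) (v 10) (v 11) (v 12) (v 13) (v 14) (v 15) (v 16) (v 17) (v 18) (v 19)
      (v 20) f₁
    + ((f₂ : ℤ) - f₁ ^ 2) ^ 2 + ((f₃ : ℤ) - f₁ * f₂) ^ 2 + ((f₄ : ℤ) - 4 * f₁ - 1) ^ 2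
    + EM4 f₁ f₂ f₃ f₄ (v 21) (v 22) (v 23) (v 24) (v 25) (v 26) (v 27) (v 28) (v 29) m
    + EHW m (v 30) (v 31) (v 32) (v 33) (v 34) (v 35) (v 36) (v 37) (v 38) (v 39) (v 40)
      (v 41) b
    + ((b : ℤ) + (4 * f₁ + 5) * (-(f₄ : ℤ) ^ 2 + d - 2 ^ n)) ^ 2

/-! The equation in `32` unknowns, in which `m = M (4 f₁)` is expressed without further unknowns
by clearing the denominator in a quotient `M (4 f₁) = L / D`. -/

/-- `L / D`, evaluated at `f₂ = f₁ ^ 2` and `f₃ = f₁ ^ 3`, is a representation of `M (4 f₁)` as a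
fraction. -/
def IsRationalForm (L D : ℕ → ℕ → ℕ → ℤ) : Prop :=
  ∀ f : ℕ, D f (f ^ 2) (f ^ 3) ≠ 0 ∧ M (4 * f) * D f (f ^ 2) (f ^ 3) = L f (f ^ 2) (f ^ 3)

/-- Common denominator of the closed forms of the six summands of `M (4 f₁)`. -/
def denM (f₁ f₂ _f₃ : ℕ) : ℤ :=
  (powU f₁ + 1) * (q1 f₁ - 1) ^ 5 * (q2 f₁ f₂ - 1) ^ 3

/-- The numerator of `M (4 f₁)` over the denominator `denM`. -/
def numM (f₁ f₂ f₃ : ℕ) : ℤ :=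
  let t₁ : ℤ := 4 * f₁
  let t : ℤ := 4 * f₁ + 1
  let n₀₁ := num0 (q2 f₁ f₂)
  let n₂₁ := num2 t₁ t (q1 f₁) (q1t1 f₁ f₂) (q2 f₁ f₂)
  let n₄₁ := num4 t₁ t (q1 f₁) (q1t1 f₁ f₂) (q2 f₁ f₂)
  let n₀₂ := num0 (q2t f₁ f₂ f₃)
  let n₁₂ := num1 t₁ t (q2 f₁ f₂) (q2t1 f₁ f₂ f₃) (q2t f₁ f₂ f₃)
  let n₂₂ := num2 t₁ t (q2 f₁ f₂) (q2t1 f₁ f₂ f₃) (q2t f₁ f₂ f₃)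
  let r₁ := q1 f₁ - 1
  let r₂ := q2 f₁ f₂ - 1
  powU f₁ * (q2t f₁ f₂ f₃ - 1) * r₁ ^ 5 * r₂ ^ 3
    + (powU f₁ + 1) * (1 - powU f₁) *
      (n₄₁ * n₀₂ * r₂ ^ 2
        - 2 * (n₂₁ * n₀₂ * r₁ ^ 2 * r₂ ^ 2)
        - 2 * (4 * f₁) * (n₂₁ * n₁₂ * r₁ ^ 2 * r₂)
        + (4 * f₁) ^ 2 * (n₀₁ * n₂₂ * r₁ ^ 4)
        + 2 * (4 * f₁) * (n₀₁ * n₁₂ * r₁ ^ 4 * r₂))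

/-- The left-hand side of the exponential Diophantine equation in `32` unknowns
`v = (a, f₁, f₂, f₃, m, b, d, y₁, …, y₂₅)` that is obtained from the fraction `L / D`. -/
def F (L D : ℕ → ℕ → ℕ → ℤ) (n : ℕ) (v : Fin 32 → ℕ) : ℤ :=
  let a := v 0
  let f₁ := v 1
  let f₂ := v 2
  let f₃ := v 3
  let m := v 4
  let b := v 5
  let d := v 6
  EFact a (v 7) (v 8) (v 9) (v 10) (v 11) (v 12) (v 13) (v 14) (v 15) (v 16) (v 17) (v 18)
      (v 19) f₁
    + ((f₂ : ℤ) - f₁ ^ 2) ^ 2 + ((f₃ : ℤ) - f₁ * f₂) ^ 2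
    + ((m : ℤ) * D f₁ f₂ f₃ - L f₁ f₂ f₃) ^ 2
    + EHW m (v 20) (v 21) (v 22) (v 23) (v 24) (v 25) (v 26) (v 27) (v 28) (v 29) (v 30)
      (v 31) b
    + ((b : ℤ) + (4 * f₁ + 5) * (-(4 * (f₁ : ℤ) + 1) ^ 2 + d - 2 ^ n)) ^ 2

/-- The `n`-th prime, for `n ≥ 1`; `p 1 = 2`. -/
noncomputable def p (n : ℕ) : ℕ := Nat.nth Nat.Prime (n - 1)

end NthPrimeEq

namespace NthPrimeEq

/-! Single-fold behaviour of the basic relations. -/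

/-! The left-hand sides are sums of nonnegative terms, so they vanish only if every block vanishes.
Each block is single-fold: it holds exactly when its output is the intended function of its inputs,
and then its auxiliary unknowns are uniquely determined. Hence a solution is determined by its first
coordinate `a`, and the problem is to show that the admissible `a` are exactly `0, …, p n - 1`.

The blocks force `f₁ = a!`, `m = M (4 a!)` and `b` equal to the Hamming weight of `m`. Put `k = 4
a!` and `u = k + 5`. In base `2 ^ (2u)` the digits of `M k` are indexed by the pairs `(x₁, x₂)` in
`[0, k]²`; the digit at a pair has weight `2u` if `x₁² = k x₂ + 1` and weight `u` otherwise
(`hw_block`, `M_eq_sum_block`). Thus `b = u ((k + 1)² + Z)`, where `Z` counts those pairs, that is,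
the square roots of `1` modulo `4 a!`. By the Chinese remainder theorem `Z = 2 ^ (π(a) + 1)`
(`numSqrtOne_four_mul_factorial`).

After division by `u` the last summand says `d + 2 ^ (π(a) + 1) = 2 ^ n`. A natural number `d`
satisfying this exists iff `π(a) < n`, that is, iff `a < p n`, and it is then unique.

The arithmetic blocks rest on three classical facts: binomial coefficients are digits of a quotient
of powers of `2` (`pow_div_mod_eq_choose`), `x!` is the integer part of `Y ^ x / Y.choose x` for
large `Y`, and the exponent of `2` in the central binomial coefficient of `x` is the Hamming weight
of `x`. -/

theorem EDiv_nonneg (x w : ℤ) (y₁ y₂ : ℕ) (z : ℤ) : 0 ≤ EDiv x w y₁ y₂ z := by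
  unfold EDiv; positivity

theorem EMod_nonneg (x w : ℤ) (y₁ y₂ : ℕ) (z : ℤ) : 0 ≤ EMod x w y₁ y₂ z := by
  unfold EMod; positivity

theorem EDvd_nonneg (x : ℤ) (y : ℕ) (w : ℤ) : 0 ≤ EDvd x y w := by
  unfold EDvd; positivity

theorem ENotDvd_nonneg (x : ℤ) (y₁ y₂ y₃ : ℕ) (w : ℤ) : 0 ≤ ENotDvd x y₁ y₂ y₃ w := by
  unfold ENotDvd; positivity

theorem add_eq_zero_iff_of_nonneg_int {a b : ℤ} (ha : 0 ≤ a) (hb : 0 ≤ b) :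
    a + b = 0 ↔ a = 0 ∧ b = 0 := by
  constructor
  · intro h; constructor <;> omega
  · rintro ⟨rfl, rfl⟩; rfl

/-- This is Euclidean division: `y₁` is the remainder, and the slack `y₂` in the second square
expresses `y₁ < w`. -/
theorem EDiv_eq_zero_iff {x w : ℕ} (hw : 0 < w) (y₁ y₂ z : ℕ) :
    EDiv x w y₁ y₂ z = 0 ↔ z = x / w ∧ y₁ = x % w ∧ y₂ = w - 1 - x % w := by
  unfold EDiv
  rw [add_eq_zero_iff_of_nonneg_int (sq_nonneg _) (sq_nonneg _), sq_eq_zero_iff, sq_eq_zero_iff]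
  have hlt := Nat.mod_lt x hw
  have hdiv := Nat.div_add_mod x w
  constructor
  · rintro ⟨h₁, h₂⟩
    have h₁' : y₁ + w * z = x := by zify; linarith
    have h₂' : y₁ + y₂ + 1 = w := by zify; linarith
    have := (Nat.div_mod_unique (a := x) (c := y₁) (d := z) hw).2 ⟨h₁', by omega⟩
    omega
  · rintro ⟨rfl, h₁, h₂⟩
    constructor
    · rw [h₁]; zify at hdiv; push_cast; linarith
    · omega

theorem EMod_eq_zero_iff {x w : ℕ} (hw : 0 < w) (y₁ y₂ z : ℕ) :
    EMod x w y₁ y₂ z = 0 ↔ z = x % w ∧ y₁ = x / w ∧ y₂ = w - 1 - x % w := by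
  unfold EMod
  rw [add_eq_zero_iff_of_nonneg_int (sq_nonneg _) (sq_nonneg _), sq_eq_zero_iff, sq_eq_zero_iff]
  have hlt := Nat.mod_lt x hw
  have hdiv := Nat.div_add_mod x w
  constructor
  · rintro ⟨h₁, h₂⟩
    have h₁' : z + w * y₁ = x := by zify; linarith
    have h₂' : z + y₂ + 1 = w := by zify; linarith
    have := (Nat.div_mod_unique (a := x) (c := z) (d := y₁) hw).2 ⟨h₁', by omega⟩
    omega
  · rintro ⟨rfl, rfl, h₂⟩
    constructor
    · zify at hdiv; push_cast; linarith
    · omega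

theorem EDvd_eq_zero_iff {w : ℕ} (hw : 0 < w) (x y : ℕ) :
    EDvd x y w = 0 ↔ w ∣ x ∧ y = x / w := by
  unfold EDvd
  rw [sq_eq_zero_iff]
  constructor
  · intro h
    have h' : x = w * y := by zify; linarith
    subst h'
    exact ⟨dvd_mul_right _ _, (Nat.mul_div_cancel_left _ hw).symm⟩
  · rintro ⟨⟨k, rfl⟩, rfl⟩
    rw [Nat.mul_div_cancel_left _ hw]; push_cast; ring

/-- The remainder is written as `y₂ + 1`, which makes it nonzero; `y₃` is the slack keeping it below
`w`. -/
theorem ENotDvd_eq_zero_iff {w : ℕ} (hw : 0 < w) (x y₁ y₂ y₃ : ℕ) :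
    ENotDvd x y₁ y₂ y₃ w = 0 ↔
      ¬ w ∣ x ∧ y₁ = x / w ∧ y₂ = x % w - 1 ∧ y₃ = w - 1 - x % w := by
  unfold ENotDvd
  rw [add_eq_zero_iff_of_nonneg_int (sq_nonneg _) (sq_nonneg _), sq_eq_zero_iff, sq_eq_zero_iff,
    Nat.dvd_iff_mod_eq_zero]
  have hlt := Nat.mod_lt x hw
  have hdiv := Nat.div_add_mod x w
  constructor
  · rintro ⟨h₁, h₂⟩
    have h₁' : y₂ + 1 + w * y₁ = x := by zify; linarith
    have h₂' : y₂ + y₃ + 2 = w := by zify; linarith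
    have := (Nat.div_mod_unique (a := x) (c := y₂ + 1) (d := y₁) hw).2 ⟨h₁', by omega⟩
    omega
  · rintro ⟨h₀, rfl, h₁, h₂⟩
    constructor
    · rw [h₁]; zify at hdiv; push_cast [Nat.one_le_iff_ne_zero.2 h₀]; linarith
    · omega

/-! Binomial coefficients as base-`q` digits of a quotient. -/

/-- Every coefficient is at most `2 ^ x < q`, so the coefficients are genuine base-`q` digits and no
carries occur. -/
theorem sum_choose_mul_pow_lt {x q : ℕ} (hq : 2 ^ x < q) (e : ℕ) :
    ∑ i ∈ Finset.range e, x.choose i * q ^ i < q ^ e := by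
  induction e with
  | zero => simp
  | succ e ih =>
    rw [Finset.sum_range_succ, pow_succ]
    have h : x.choose e + 1 ≤ q := by
      have := Nat.choose_le_two_pow x e
      omega
    nlinarith [Nat.mul_le_mul_right (q ^ e) h]

theorem exists_add_one_pow_eq (x q e : ℕ) : ∃ H : ℕ, (q + 1) ^ x =
    ∑ i ∈ Finset.range e, x.choose i * q ^ i + q ^ e * (x.choose e + q * H) := by
  have h : (q + 1) ^ x = ∑ i ∈ Finset.range (e + 1 + x), x.choose i * q ^ i := by
    rw [add_pow]
    simp only [one_pow, mul_one, mul_comm]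
    refine Finset.sum_subset (by intro i; simp; omega) ?_
    intro i _ hi
    rw [Nat.choose_eq_zero_of_lt (by simpa [Nat.lt_succ_iff] using hi), Nat.cast_zero, mul_zero]
  refine ⟨∑ i ∈ Finset.range x, x.choose (e + 1 + i) * q ^ i, ?_⟩
  rw [h, Finset.sum_range_add, Finset.sum_range_succ, mul_add, add_assoc, Finset.mul_sum,
    Finset.mul_sum]
  congr 2
  · ring
  · refine Finset.sum_congr rfl fun i _ => ?_
    ring

/-- Put `Q = q ^ (x + 2)`, `W = Q - q - 1` and `e = x - w`; the dividend is `Q ^ (x + 1) / q ^ e`. A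
geometric sum `T` gives `Q ^ x = T W + (q + 1) ^ x`, hence `Q ^ (x + 1) = W (T Q + (q + 1) ^ x) + (q
+ 1) ^ (x + 1)` with remainder below `W`. Since `e < x + 2`, the `e`-th base-`q` digit of the
quotient is that of `(q + 1) ^ x`, namely `x.choose e = x.choose w`. -/
theorem pow_div_mod_eq_choose {x w q : ℕ} (hw : w ≤ x) (hq : q = 2 ^ (2 * x + 4)) :
    (q + 1) < q ^ (x + 2) ∧
    q ^ (x ^ 2 + 2 * x + 2 + w) / (q ^ (x + 2) - q - 1) % q = x.choose w := by
  have hq2 : 2 ^ (x + 1) + 2 < q := by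
    rw [hq]
    calc 2 ^ (x + 1) + 2 ≤ 2 ^ (x + 1) + 2 ^ (x + 1) := by
          gcongr
          exact Nat.le_self_pow (by omega) 2
      _ = 2 ^ (x + 2) := by ring
      _ < 2 ^ (2 * x + 4) := Nat.pow_lt_pow_right (by norm_num) (by omega)
  have hq0 : 0 < q := (Nat.zero_le _).trans_lt hq2
  have hxq : 2 ^ x < q := by
    have : 2 ^ x ≤ 2 ^ (x + 1) := Nat.pow_le_pow_right (by norm_num) (Nat.le_succ x)
    linarith
  have hWpos : (q + 1) ^ (x + 1) + (q + 1) < q ^ (x + 2) := by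
    have h₁ : (q + 1) ^ (x + 1) ≤ (2 * q) ^ (x + 1) := by gcongr; omega
    have h₂ : q ≤ q ^ (x + 1) := Nat.le_self_pow (by omega) q
    rw [mul_pow] at h₁
    have h₃ : (2 ^ (x + 1) + 2) * q ^ (x + 1) < q * q ^ (x + 1) := by gcongr
    have h₄ : q * q ^ (x + 1) = q ^ (x + 2) := by ring
    nlinarith
  obtain ⟨W, hW⟩ : ∃ W, q ^ (x + 2) = W + (q + 1) :=
    ⟨q ^ (x + 2) - (q + 1), by omega⟩
  have hWq : q ^ (x + 2) - q - 1 = W := by omega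
  refine ⟨by omega, ?_⟩
  rw [hWq]
  obtain ⟨e, he⟩ : ∃ e, x = w + e := ⟨x - w, by omega⟩
  obtain ⟨H, hH⟩ := exists_add_one_pow_eq x q e
  set L := ∑ i ∈ Finset.range e, x.choose i * q ^ i with hL
  have hLlt : L < q ^ e := sum_choose_mul_pow_lt hxq e
  have hsymm : x.choose e = x.choose w := Nat.choose_symm_of_eq_add (by omega)
  rw [hsymm] at hH
  set T := ∑ i ∈ Finset.range x, (q ^ (x + 2)) ^ i * (q + 1) ^ (x - 1 - i) with hT
  have hgeom : T * W + (q + 1) ^ x = (q ^ (x + 2)) ^ x := by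
    have := (Commute.all ((q : ℤ) ^ (x + 2)) (q + 1)).geom_sum₂_mul x
    have h2 : (q : ℤ) ^ (x + 2) = W + (q + 1) := by exact_mod_cast hW
    have h3 : (q : ℤ) ^ (x + 2) - (q + 1) = W := by rw [h2]; ring
    rw [h3] at this
    zify
    rw [hT]; push_cast
    linarith
  -- the quotient
  set Q := x.choose w + q * (H + q ^ (w + 1) * T) with hQ
  -- The factor `q ^ e` completes the dividend to `Q ^ (x + 1)`, so that the geometric identity
  -- applies; `L` collects the digits of `(q + 1) ^ x` below position `e`.
  have hmain : q ^ e * q ^ (x ^ 2 + 2 * x + 2 + w) =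
      q ^ e * (W * Q) + ((q + 1) ^ (x + 1) + W * L) := by
    have e1 : q ^ e * q ^ (x ^ 2 + 2 * x + 2 + w) = (q ^ (x + 2)) ^ x * q ^ (x + 2) := by
      rw [← pow_add, ← pow_mul, ← pow_add]; congr 1; rw [he]; ring
    have e2 : q ^ (x + 2) = q ^ e * (q * q ^ (w + 1)) := by
      rw [← pow_succ', ← pow_add]; congr 1; omega
    rw [e1, ← hgeom, add_mul]
    calc T * W * q ^ (x + 2) + (q + 1) ^ x * q ^ (x + 2)
        = T * W * (q ^ e * (q * q ^ (w + 1))) + (q + 1) ^ x * (W + (q + 1)) := by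
          rw [← e2, ← hW]
      _ = T * W * (q ^ e * (q * q ^ (w + 1))) + (q + 1) ^ (x + 1)
          + (L + q ^ e * (x.choose w + q * H)) * W := by
          rw [← hH]; ring
      _ = _ := by rw [hQ]; ring
  -- As `L + 1 ≤ q ^ e`, one copy of `W` is left over, and it absorbs `(q + 1) ^ (x + 1)`.
  have hlt : (q + 1) ^ (x + 1) + W * L < q ^ e * W := by
    have h5 : (q + 1) ^ (x + 1) < W := by omega
    nlinarith [Nat.mul_le_mul_left W hLlt]
  have hdiv : q ^ (x ^ 2 + 2 * x + 2 + w) / W = Q := by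
    have hqe : 0 < q ^ e := by positivity
    have hWpos' : 0 < W := by omega
    apply Nat.div_eq_of_lt_le
    · rw [mul_comm Q W]
      exact le_of_mul_le_mul_left (by omega) hqe
    · refine lt_of_mul_lt_mul_left (a := q ^ e) ?_ (Nat.zero_le _)
      rw [hmain]; nlinarith
  rw [hdiv, hQ, Nat.add_mul_mod_self_left]
  apply Nat.mod_eq_of_lt
  exact lt_of_le_of_lt (Nat.choose_le_two_pow x w) hxq

theorem EBinom_nonneg (x w y₁ y₂ y₃ y₄ y₅ y₆ y₇ z : ℕ) :
    0 ≤ EBinom x w y₁ y₂ y₃ y₄ y₅ y₆ y₇ z := by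
  unfold EBinom
  have := EDiv_nonneg (2 ^ y₁) (2 ^ y₂ - 2 ^ (2 * x + 4) - 1) y₄ y₅ y₃
  have := EMod_nonneg y₃ (2 ^ (2 * x + 4)) y₆ y₇ z
  positivity

theorem EBinom_single_fold {x w : ℕ} (hw : w ≤ x) : ∃ W : Fin 7 → ℕ,
    ∀ y₁ y₂ y₃ y₄ y₅ y₆ y₇ z : ℕ, EBinom x w y₁ y₂ y₃ y₄ y₅ y₆ y₇ z = 0 ↔
      z = x.choose w ∧ y₁ = W 0 ∧ y₂ = W 1 ∧ y₃ = W 2 ∧ y₄ = W 3 ∧ y₅ = W 4 ∧ y₆ = W 5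
        ∧ y₇ = W 6 := by
  obtain ⟨hlt, hch⟩ := pow_div_mod_eq_choose hw rfl
  set q := 2 ^ (2 * x + 4) with hq
  set N := q ^ (x ^ 2 + 2 * x + 2 + w) with hN
  set D := q ^ (x + 2) - q - 1 with hD
  have hDpos : 0 < D := by omega
  have hN' : 2 ^ (2 * x ^ 3 + 8 * x ^ 2 + 2 * x * w + 12 * x + 4 * w + 8) = N := by
    rw [hN, hq, ← pow_mul]; congr 1; ring
  have hD' : ((2 : ℤ) ^ (2 * x ^ 2 + 8 * x + 8) - 2 ^ (2 * x + 4) - 1) = (D : ℕ) := by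
    have : q ^ (x + 2) = 2 ^ (2 * x ^ 2 + 8 * x + 8) := by
      rw [hq, ← pow_mul]; congr 1; ring
    have h' : 2 ^ (2 * x ^ 2 + 8 * x + 8) = D + q + 1 := by omega
    zify at h'
    rw [h', hq]; push_cast; ring
  refine ⟨![2 * x ^ 3 + 8 * x ^ 2 + 2 * x * w + 12 * x + 4 * w + 8, 2 * x ^ 2 + 8 * x + 8,
    N / D, N % D, D - 1 - N % D, N / D / q, q - 1 - N / D % q], ?_⟩
  intro y₁ y₂ y₃ y₄ y₅ y₆ y₇ z
  unfold EBinom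
  have p3 := EDiv_nonneg (2 ^ y₁) (2 ^ y₂ - 2 ^ (2 * x + 4) - 1) y₄ y₅ y₃
  have p4 := EMod_nonneg y₃ (2 ^ (2 * x + 4)) y₆ y₇ z
  rw [add_eq_zero_iff_of_nonneg_int (by positivity) p4,
    add_eq_zero_iff_of_nonneg_int (by positivity) p3,
    add_eq_zero_iff_of_nonneg_int (by positivity) (by positivity), sq_eq_zero_iff, sq_eq_zero_iff,
    sub_eq_zero, sub_eq_zero]
  have c1 : (y₁ : ℤ) = 2 * x ^ 3 + 8 * x ^ 2 + 2 * x * w + 12 * x + 4 * w + 8 ↔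
      y₁ = 2 * x ^ 3 + 8 * x ^ 2 + 2 * x * w + 12 * x + 4 * w + 8 := by
    exact_mod_cast Iff.rfl
  have c2 : (y₂ : ℤ) = 2 * x ^ 2 + 8 * x + 8 ↔ y₂ = 2 * x ^ 2 + 8 * x + 8 := by
    exact_mod_cast Iff.rfl
  rw [c1, c2]
  have c4 : EMod y₃ (2 ^ (2 * x + 4)) y₆ y₇ z = 0 ↔
      z = y₃ % q ∧ y₆ = y₃ / q ∧ y₇ = q - 1 - y₃ % q := by
    rw [← EMod_eq_zero_iff (by positivity)]; push_cast [hq]; rfl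
  rw [c4]
  have c3 : y₁ = 2 * x ^ 3 + 8 * x ^ 2 + 2 * x * w + 12 * x + 4 * w + 8 →
      y₂ = 2 * x ^ 2 + 8 * x + 8 → (EDiv (2 ^ y₁) (2 ^ y₂ - 2 ^ (2 * x + 4) - 1) y₄ y₅ y₃ = 0 ↔
      y₃ = N / D ∧ y₄ = N % D ∧ y₅ = D - 1 - N % D) := by
    rintro rfl rfl
    rw [← EDiv_eq_zero_iff hDpos, hD', ← hN']
    push_cast; rfl
  simp only [Fin.isValue, Matrix.cons_val]
  constructor
  · rintro ⟨⟨⟨h1, h2⟩, h3⟩, h4, h5, h6⟩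
    obtain ⟨rfl, h7, h8⟩ := (c3 h1 h2).1 h3
    exact ⟨h4.trans hch, h1, h2, rfl, h7, h8, h5, h6⟩
  · rintro ⟨h1, h2, h3, h4, h5, h6, h7, h8⟩
    refine ⟨⟨⟨h2, h3⟩, (c3 h2 h3).2 ⟨h4, h5, h6⟩⟩, ?_⟩
    subst h4
    exact ⟨h1.trans hch.symm, h7, h8⟩

/-! Factorials. -/

/-- Since `x! * Y.choose x` is the descending factorial of `Y`, it is at most `Y ^ x` and differs
from it by a relative error of at most `x² / Y`, which is too small to raise the quotient to `x! +
1`. -/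
theorem pow_div_choose_eq_factorial (x : ℕ) :
    (2 ^ (3 * x ^ 2)) ^ x / (2 ^ (3 * x ^ 2)).choose x = x.factorial := by
  set Y := 2 ^ (3 * x ^ 2) with hY
  have hxY : x ≤ Y := by
    calc x ≤ 2 ^ x := Nat.lt_two_pow_self.le
      _ ≤ Y := Nat.pow_le_pow_right (by norm_num) (by nlinarith)
  have hC := Nat.descFactorial_eq_factorial_mul_choose Y x
  have hfpos := Nat.factorial_pos x
  apply Nat.div_eq_of_lt_le
  · rw [← hC]; exact Nat.descFactorial_le_pow Y x
  · have key : x.factorial * Y ^ x < (x.factorial + 1) * Y.descFactorial x := by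
      rcases Nat.lt_or_ge x 2 with hx | hx
      · interval_cases x <;> simp [hY]
      · have hbig : (x.factorial + 1) * (x * x) < Y := by
          have h1 : x.factorial ≤ x ^ x := Nat.factorial_le_pow x
          have h2 : 1 ≤ x ^ x := Nat.one_le_pow _ _ (by omega)
          have h3 : x < 2 ^ x := Nat.lt_two_pow_self
          calc (x.factorial + 1) * (x * x) ≤ (2 * x ^ x) * (x * x) := by gcongr; omega
            _ = 2 * x ^ (x + 2) := by ring
            _ < 2 * (2 ^ x) ^ (x + 2) := by gcongr
            _ = 2 ^ (x * (x + 2) + 1) := by rw [← pow_mul]; ring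
            _ ≤ Y := Nat.pow_le_pow_right (by norm_num) (by nlinarith)
        -- A Bernoulli-type estimate for `(Y - x) ^ x`, proved with `Y = r + x` to avoid truncated
        -- subtraction.
        have hber : Y ^ x ≤ Y.descFactorial x + x * x * Y ^ (x - 1) := by
          have h1 : (Y + 1 - x) ^ x ≤ Y.descFactorial x := Nat.pow_sub_le_descFactorial Y x
          obtain ⟨r, hr⟩ : ∃ r, Y = r + x := ⟨Y - x, by omega⟩
          have h2 : ∀ k, (r + x) ^ k ≤ r ^ k + k * x * (r + x) ^ (k - 1) := by
            intro k
            induction k with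
            | zero => simp
            | succ k ih =>
              rcases k with _ | k
              · simp
              · simp only [Nat.add_sub_cancel] at ih ⊢
                have h4 : (r + x) ^ (k + 1 + 1) = (r + x) * (r + x) ^ (k + 1) := by ring
                have h5 : r ^ (k + 1) ≤ (r + x) ^ (k + 1) := by gcongr; omega
                have h6 : (r + x) ^ (k + 1) = (r + x) * (r + x) ^ k := by ring
                calc (r + x) ^ (k + 1 + 1) ≤ (r + x) * (r ^ (k + 1) + (k + 1) * x * (r + x) ^ k) := by
                      rw [h4]; gcongr
                  _ = r ^ (k + 1 + 1) + x * r ^ (k + 1) + (k + 1) * x * (r + x) ^ (k + 1) := by ring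
                  _ ≤ r ^ (k + 1 + 1) + x * (r + x) ^ (k + 1) + (k + 1) * x * (r + x) ^ (k + 1) := by
                      gcongr
                  _ = _ := by ring
          have h3 : r ^ x ≤ (Y + 1 - x) ^ x := by gcongr; omega
          have := h2 x
          rw [← hr] at this
          omega
        have hYx : Y ^ x = Y * Y ^ (x - 1) := by
          rw [← pow_succ']; congr 1; omega
        have hp : 0 < Y ^ (x - 1) := by positivity
        nlinarith [Nat.mul_le_mul_left (x.factorial + 1) hber,
          Nat.mul_lt_mul_of_pos_right hbig hp]
    rw [hC] at key
    refine lt_of_mul_lt_mul_left (a := x.factorial) ?_ (Nat.zero_le _)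
    nlinarith

theorem EFact_nonneg (x y₁ y₂ y₃ y₄ y₅ y₆ y₇ y₈ y₉ y₁₀ y₁₁ y₁₂ y₁₃ z : ℕ) :
    0 ≤ EFact x y₁ y₂ y₃ y₄ y₅ y₆ y₇ y₈ y₉ y₁₀ y₁₁ y₁₂ y₁₃ z := by
  unfold EFact
  have := EBinom_nonneg y₂ x y₅ y₆ y₇ y₈ y₉ y₁₀ y₁₁ y₄
  have := EDiv_nonneg (2 ^ (3 * y₃)) y₄ y₁₂ y₁₃ z
  positivity

theorem EFact_single_fold (x : ℕ) : ∃ W : Fin 13 → ℕ,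
    ∀ y₁ y₂ y₃ y₄ y₅ y₆ y₇ y₈ y₉ y₁₀ y₁₁ y₁₂ y₁₃ z : ℕ,
      EFact x y₁ y₂ y₃ y₄ y₅ y₆ y₇ y₈ y₉ y₁₀ y₁₁ y₁₂ y₁₃ z = 0 ↔
      z = x.factorial ∧ y₁ = W 0 ∧ y₂ = W 1 ∧ y₃ = W 2 ∧ y₄ = W 3 ∧ y₅ = W 4 ∧ y₆ = W 5
        ∧ y₇ = W 6 ∧ y₈ = W 7 ∧ y₉ = W 8 ∧ y₁₀ = W 9 ∧ y₁₁ = W 10 ∧ y₁₂ = W 11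
        ∧ y₁₃ = W 12 := by
  set Y := 2 ^ (3 * x ^ 2) with hY
  have hxY : x ≤ Y := by
    calc x ≤ 2 ^ x := Nat.lt_two_pow_self.le
      _ ≤ Y := Nat.pow_le_pow_right (by norm_num) (by nlinarith)
  obtain ⟨W, hW⟩ := EBinom_single_fold hxY
  have hfac := pow_div_choose_eq_factorial x
  rw [← hY] at hfac
  set C := Y.choose x with hC
  have hCpos : 0 < C := Nat.choose_pos hxY
  refine ⟨![x ^ 2, Y, x * x ^ 2, C, W 0, W 1, W 2, W 3, W 4, W 5, W 6, Y ^ x % C,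
    C - 1 - Y ^ x % C], ?_⟩
  intro y₁ y₂ y₃ y₄ y₅ y₆ y₇ y₈ y₉ y₁₀ y₁₁ y₁₂ y₁₃ z
  unfold EFact
  have p4 := EBinom_nonneg y₂ x y₅ y₆ y₇ y₈ y₉ y₁₀ y₁₁ y₄
  have p5 := EDiv_nonneg (2 ^ (3 * y₃)) y₄ y₁₂ y₁₃ z
  rw [add_eq_zero_iff_of_nonneg_int (by positivity) p5,
    add_eq_zero_iff_of_nonneg_int (by positivity) p4,
    add_eq_zero_iff_of_nonneg_int (by positivity) (by positivity),
    add_eq_zero_iff_of_nonneg_int (by positivity) (by positivity), sq_eq_zero_iff, sq_eq_zero_iff,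
    sq_eq_zero_iff, sub_eq_zero, sub_eq_zero, sub_eq_zero]
  have c1 : (y₁ : ℤ) = x ^ 2 ↔ y₁ = x ^ 2 := by exact_mod_cast Iff.rfl
  have c2 : (y₂ : ℤ) = 2 ^ (3 * y₁) ↔ y₂ = 2 ^ (3 * y₁) := by exact_mod_cast Iff.rfl
  have c3 : (y₃ : ℤ) = x * y₁ ↔ y₃ = x * y₁ := by exact_mod_cast Iff.rfl
  rw [c1, c2, c3]
  have c5 : EDiv (2 ^ (3 * (x * x ^ 2))) C y₁₂ y₁₃ z = 0 ↔
      z = x.factorial ∧ y₁₂ = Y ^ x % C ∧ y₁₃ = C - 1 - Y ^ x % C := by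
    have h := EDiv_eq_zero_iff (x := Y ^ x) hCpos y₁₂ y₁₃ z
    rw [hfac] at h
    rw [← h, hY, ← pow_mul]
    push_cast
    rw [show 3 * (x * x ^ 2) = 3 * x ^ 2 * x by ring]
  simp only [Fin.isValue, Matrix.cons_val]
  constructor
  · rintro ⟨⟨⟨⟨rfl, rfl⟩, rfl⟩, h4⟩, h5⟩
    obtain ⟨rfl, h6⟩ := (hW ..).1 h4
    have h7 := c5.1 h5
    tauto
  · rintro ⟨h0, rfl, rfl, rfl, rfl, h⟩
    refine ⟨⟨⟨⟨rfl, rfl⟩, rfl⟩, (hW ..).2 ?_⟩, c5.2 ?_⟩ <;> tauto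

/-! The exponent of `2` and the Hamming weight. -/

theorem ENu_nonneg (x y₁ y₂ y₃ y₄ z : ℕ) : 0 ≤ ENu x y₁ y₂ y₃ y₄ z :=
  add_nonneg (ENotDvd_nonneg _ _ _ _ _) (EDvd_nonneg _ _ _)

theorem ENu_single_fold {x : ℕ} (hx : x ≠ 0) : ∃ W : Fin 4 → ℕ,
    ∀ y₁ y₂ y₃ y₄ z : ℕ, ENu x y₁ y₂ y₃ y₄ z = 0 ↔
      z = padicValNat 2 x ∧ y₁ = W 0 ∧ y₂ = W 1 ∧ y₃ = W 2 ∧ y₄ = W 3 := by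
  set k := padicValNat 2 x with hk
  refine ⟨![x / 2 ^ (k + 1), x % 2 ^ (k + 1) - 1, 2 ^ (k + 1) - 1 - x % 2 ^ (k + 1),
    x / 2 ^ k], ?_⟩
  intro y₁ y₂ y₃ y₄ z
  unfold ENu
  have h1 := ENotDvd_eq_zero_iff (w := 2 ^ (z + 1)) (by positivity) x y₁ y₂ y₃
  have h2 := EDvd_eq_zero_iff (w := 2 ^ z) (by positivity) x y₄
  push_cast at h1 h2
  rw [add_eq_zero_iff_of_nonneg_int (ENotDvd_nonneg _ _ _ _ _) (EDvd_nonneg _ _ _), h1, h2,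
    padicValNat_dvd_iff_le hx, padicValNat_dvd_iff_le hx, ← hk]
  simp only [Fin.isValue, Matrix.cons_val]
  constructor
  · rintro ⟨⟨h3, h4⟩, h5, h6⟩
    obtain rfl : z = k := by omega
    tauto
  · rintro ⟨rfl, h⟩
    refine ⟨⟨by omega, ?_⟩, le_rfl, ?_⟩ <;> tauto

/-- Legendre's formula gives `s(x) + s(x) - s(2x)` for the binary digit sum `s`, and doubling only
appends a digit `0`. -/
theorem padicValNat_two_choose_two_mul_self (x : ℕ) :
    padicValNat 2 ((2 * x).choose x) = (Nat.digits 2 x).sum := by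
  have h := sub_one_mul_padicValNat_choose_eq_sub_sum_digits (p := 2) (k := x) (n := 2 * x)
    (by omega)
  have h2 : (Nat.digits 2 (2 * x)).sum = (Nat.digits 2 x).sum := by
    rcases Nat.eq_zero_or_pos x with rfl | hx
    · rfl
    · rw [Nat.digits_def' (by norm_num) (by omega)]
      simp
  rw [h2, show 2 * x - x = x by omega] at h
  omega

theorem EHW_nonneg (x y₁ y₂ y₃ y₄ y₅ y₆ y₇ y₈ y₉ y₁₀ y₁₁ y₁₂ z : ℕ) :
    0 ≤ EHW x y₁ y₂ y₃ y₄ y₅ y₆ y₇ y₈ y₉ y₁₀ y₁₁ y₁₂ z :=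
  add_nonneg (EBinom_nonneg ..) (ENu_nonneg ..)

theorem EHW_single_fold (x : ℕ) : ∃ W : Fin 12 → ℕ,
    ∀ y₁ y₂ y₃ y₄ y₅ y₆ y₇ y₈ y₉ y₁₀ y₁₁ y₁₂ z : ℕ,
      EHW x y₁ y₂ y₃ y₄ y₅ y₆ y₇ y₈ y₉ y₁₀ y₁₁ y₁₂ z = 0 ↔
      z = (Nat.digits 2 x).sum ∧ y₁ = W 0 ∧ y₂ = W 1 ∧ y₃ = W 2 ∧ y₄ = W 3 ∧ y₅ = W 4
        ∧ y₆ = W 5 ∧ y₇ = W 6 ∧ y₈ = W 7 ∧ y₉ = W 8 ∧ y₁₀ = W 9 ∧ y₁₁ = W 10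
        ∧ y₁₂ = W 11 := by
  have hx : x ≤ 2 * x := by omega
  obtain ⟨W, hW⟩ := EBinom_single_fold hx
  obtain ⟨V, hV⟩ := ENu_single_fold (Nat.choose_pos hx).ne'
  rw [padicValNat_two_choose_two_mul_self] at hV
  refine ⟨![(2 * x).choose x, W 0, W 1, W 2, W 3, W 4, W 5, W 6, V 0, V 1, V 2, V 3], ?_⟩
  intro y₁ y₂ y₃ y₄ y₅ y₆ y₇ y₈ y₉ y₁₀ y₁₁ y₁₂ z
  unfold EHW
  rw [add_eq_zero_iff_of_nonneg_int (EBinom_nonneg ..) (ENu_nonneg ..), hW]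
  simp only [Fin.isValue, Matrix.cons_val]
  constructor
  · rintro ⟨⟨rfl, h1⟩, h2⟩
    have h3 := (hV ..).1 h2
    tauto
  · rintro ⟨h0, rfl, h⟩
    refine ⟨?_, (hV ..).2 ?_⟩ <;> tauto

/-! Closed forms of the generalized geometric progressions. -/

theorem G_succ (r : ℕ) (q : ℤ) (t : ℕ) : G r q (t + 1) = G r q t + (t : ℤ) ^ r * q ^ t :=
  Finset.sum_range_succ _ _

theorem G_one (r : ℕ) (q : ℤ) : G r q 1 = 0 ^ r := by
  simp [G]

theorem G_nonneg (r : ℕ) {q : ℤ} (hq : 0 ≤ q) (t : ℕ) : 0 ≤ G r q t :=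
  Finset.sum_nonneg fun _ _ => by positivity

theorem G_zero_mul (q : ℤ) (t : ℕ) : G 0 q (t + 1) * (q - 1) = num0 (q ^ (t + 1)) := by
  unfold num0
  induction t with
  | zero => rw [G_one]; ring
  | succ t ih => rw [G_succ, add_mul, ih]; ring

theorem G_one_mul (q : ℤ) (t : ℕ) :
    G 1 q (t + 1) * (q - 1) ^ 2 = num1 t (t + 1) q (q ^ t) (q ^ (t + 1)) := by
  unfold num1
  induction t with
  | zero => rw [G_one]; push_cast; ring
  | succ t ih => rw [G_succ, add_mul, ih]; push_cast; ring

theorem G_two_mul (q : ℤ) (t : ℕ) :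
    G 2 q (t + 1) * (q - 1) ^ 3 = num2 t (t + 1) q (q ^ t) (q ^ (t + 1)) := by
  unfold num2
  induction t with
  | zero => rw [G_one]; push_cast; ring
  | succ t ih => rw [G_succ, add_mul, ih]; push_cast; ring

theorem G_four_mul (q : ℤ) (t : ℕ) :
    G 4 q (t + 1) * (q - 1) ^ 5 = num4 t (t + 1) q (q ^ t) (q ^ (t + 1)) := by
  unfold num4
  induction t with
  | zero => rw [G_one]; push_cast; ring
  | succ t ih => rw [G_succ, add_mul, ih]; push_cast; ring

/-- The product of the two geometric sums is a single one of length `(t + 1)²` in the ratio `2 ^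
(2u)`, and `2 ^ (2u) - 1 = (2 ^ u - 1)(2 ^ u + 1)`. This makes the division in `termC` exact. -/
theorem pow_sub_one_eq_mul_G (u t : ℕ) :
    (2 : ℤ) ^ (2 * u * (t + 1) ^ 2) - 1 = (2 ^ u + 1) * ((2 ^ u - 1) *
      (G 0 (2 ^ (2 * u)) (t + 1) * G 0 (2 ^ (2 * u * (t + 1))) (t + 1))) := by
  have h1 := G_zero_mul (2 ^ (2 * u)) t
  have h2 := G_zero_mul (2 ^ (2 * u * (t + 1))) t
  unfold num0 at h1 h2
  rw [← pow_mul] at h1 h2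
  rw [show 2 * u * (t + 1) ^ 2 = 2 * u * (t + 1) * (t + 1) by ring, ← h2, ← h1,
    show (2 : ℤ) ^ (2 * u) = (2 ^ u) ^ 2 by rw [← pow_mul, mul_comm]]
  ring

theorem termC_one_eq (u t : ℕ) :
    termC 1 (t + 1) u = 2 ^ u * ((2 ^ u - 1) *
      (G 0 (2 ^ (2 * u)) (t + 1) * G 0 (2 ^ (2 * u * (t + 1))) (t + 1))) := by
  unfold termC
  rw [pow_sub_one_eq_mul_G]
  apply Int.ediv_eq_of_eq_mul_right (by positivity)
  ring

theorem termC_one_mul (u t : ℕ) :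
    termC 1 (t + 1) u * (2 ^ u + 1) = 2 ^ u * (2 ^ (2 * u * (t + 1) ^ 2) - 1) := by
  rw [termC_one_eq, pow_sub_one_eq_mul_G]; ring

theorem termC_one_nonneg (u t : ℕ) : 0 ≤ termC 1 (t + 1) u := by
  rw [termC_one_eq]
  have h1 := G_nonneg 0 (q := 2 ^ (2 * u)) (by positivity) (t + 1)
  have h2 := G_nonneg 0 (q := 2 ^ (2 * u * (t + 1))) (by positivity) (t + 1)
  have h3 : (0 : ℤ) ≤ 2 ^ u - 1 := sub_nonneg.2 (one_le_pow₀ (by norm_num))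
  positivity

theorem M_eq (n : ℕ) : M n = termC 1 (n + 1) (n + 5) + (1 - 2 ^ (n + 5)) *
    (G 4 (2 ^ (2 * (n + 5))) (n + 1) * G 0 (2 ^ (2 * (n + 5) * (n + 1))) (n + 1)
      - 2 * (G 2 (2 ^ (2 * (n + 5))) (n + 1) * G 0 (2 ^ (2 * (n + 5) * (n + 1))) (n + 1))
      - 2 * n * (G 2 (2 ^ (2 * (n + 5))) (n + 1) * G 1 (2 ^ (2 * (n + 5) * (n + 1))) (n + 1))
      + n ^ 2 * (G 0 (2 ^ (2 * (n + 5))) (n + 1) * G 2 (2 ^ (2 * (n + 5) * (n + 1))) (n + 1))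
      + 2 * n * (G 0 (2 ^ (2 * (n + 5))) (n + 1)
        * G 1 (2 ^ (2 * (n + 5) * (n + 1))) (n + 1))) := by
  unfold M termA
  ring

/-! The powers of `2` that occur in the equations. -/

theorem powU_eq (f : ℕ) : powU f = 2 ^ (4 * f + 5) := rfl

theorem q1_eq (f : ℕ) : q1 f = 2 ^ (2 * (4 * f + 5)) := by
  unfold q1; congr 1; ring

theorem q1t1_eq (f : ℕ) : q1t1 f (f ^ 2) = q1 f ^ (4 * f) := by
  unfold q1t1 q1; rw [← pow_mul]; congr 1; ring

theorem q2_eq_pow (f : ℕ) : q2 f (f ^ 2) = q1 f ^ (4 * f + 1) := by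
  unfold q2 q1; rw [← pow_mul]; congr 1; ring

theorem q2_eq (f : ℕ) : q2 f (f ^ 2) = 2 ^ (2 * (4 * f + 5) * (4 * f + 1)) := by
  unfold q2; congr 1; ring

theorem q2t1_eq (f : ℕ) : q2t1 f (f ^ 2) (f ^ 3) = q2 f (f ^ 2) ^ (4 * f) := by
  unfold q2t1 q2; rw [← pow_mul]; congr 1; ring

theorem q2t_eq_pow (f : ℕ) : q2t f (f ^ 2) (f ^ 3) = q2 f (f ^ 2) ^ (4 * f + 1) := by
  unfold q2t q2; rw [← pow_mul]; congr 1; ring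

theorem q2t_eq (f : ℕ) :
    q2t f (f ^ 2) (f ^ 3) = 2 ^ (2 * (4 * f + 5) * (4 * f + 1) ^ 2) := by
  unfold q2t; congr 1; ring

theorem one_lt_q1 (f : ℕ) : 1 < q1 f := one_lt_pow₀ (by norm_num) (by omega)

theorem one_lt_q2 (f₁ f₂ : ℕ) : 1 < q2 f₁ f₂ := one_lt_pow₀ (by norm_num) (by omega)

theorem powU_pos (f : ℕ) : 0 < powU f := by unfold powU; positivity

/-- The constant contribution to `M (4 f)` and the progressions that occur in it. -/
theorem exists_M_components (f : ℕ) : ∃ g₀₁ g₂₁ g₄₁ g₀₂ g₁₂ g₂₂ c : ℕ,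
    (g₀₁ : ℤ) * (q1 f - 1) = num0 (q2 f (f ^ 2)) ∧
    (g₀₂ : ℤ) * (q2 f (f ^ 2) - 1) = num0 (q2t f (f ^ 2) (f ^ 3)) ∧
    (g₁₂ : ℤ) * (q2 f (f ^ 2) - 1) ^ 2 = num1 (4 * f) (4 * f + 1) (q2 f (f ^ 2))
      (q2t1 f (f ^ 2) (f ^ 3)) (q2t f (f ^ 2) (f ^ 3)) ∧
    (g₂₁ : ℤ) * (q1 f - 1) ^ 3 = num2 (4 * f) (4 * f + 1) (q1 f) (q1t1 f (f ^ 2))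
      (q2 f (f ^ 2)) ∧
    (g₂₂ : ℤ) * (q2 f (f ^ 2) - 1) ^ 3 = num2 (4 * f) (4 * f + 1) (q2 f (f ^ 2))
      (q2t1 f (f ^ 2) (f ^ 3)) (q2t f (f ^ 2) (f ^ 3)) ∧
    (g₄₁ : ℤ) * (q1 f - 1) ^ 5 = num4 (4 * f) (4 * f + 1) (q1 f) (q1t1 f (f ^ 2))
      (q2 f (f ^ 2)) ∧
    (c : ℤ) * (powU f + 1) = powU f * (q2t f (f ^ 2) (f ^ 3) - 1) ∧
    M (4 * f) = c + (1 - powU f) * (g₄₁ * g₀₂ - 2 * (g₂₁ * g₀₂) - 2 * (4 * f) * (g₂₁ * g₁₂)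
      + (4 * f) ^ 2 * (g₀₁ * g₂₂) + 2 * (4 * f) * (g₀₁ * g₁₂)) := by
  have hq1 : 0 ≤ q1 f := (zero_lt_one.trans (one_lt_q1 f)).le
  have hq2 : 0 ≤ q2 f (f ^ 2) := (zero_lt_one.trans (one_lt_q2 f _)).le
  refine ⟨(G 0 (q1 f) (4 * f + 1)).toNat, (G 2 (q1 f) (4 * f + 1)).toNat,
    (G 4 (q1 f) (4 * f + 1)).toNat, (G 0 (q2 f (f ^ 2)) (4 * f + 1)).toNat,
    (G 1 (q2 f (f ^ 2)) (4 * f + 1)).toNat, (G 2 (q2 f (f ^ 2)) (4 * f + 1)).toNat,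
    (termC 1 (4 * f + 1) (4 * f + 5)).toNat, ?_⟩
  rw [Int.toNat_of_nonneg (G_nonneg 0 hq1 _), Int.toNat_of_nonneg (G_nonneg 2 hq1 _),
    Int.toNat_of_nonneg (G_nonneg 4 hq1 _), Int.toNat_of_nonneg (G_nonneg 0 hq2 _),
    Int.toNat_of_nonneg (G_nonneg 1 hq2 _), Int.toNat_of_nonneg (G_nonneg 2 hq2 _),
    Int.toNat_of_nonneg (termC_one_nonneg _ _)]
  refine ⟨?_, ?_, ?_, ?_, ?_, ?_, ?_, ?_⟩
  · rw [G_zero_mul, q2_eq_pow]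
  · rw [G_zero_mul, q2t_eq_pow]
  · rw [G_one_mul, q2t_eq_pow, q2t1_eq]; push_cast; rfl
  · rw [G_two_mul, q1t1_eq, q2_eq_pow]; push_cast; rfl
  · rw [G_two_mul, q2t_eq_pow, q2t1_eq]; push_cast; rfl
  · rw [G_four_mul, q1t1_eq, q2_eq_pow]; push_cast; rfl
  · rw [powU_eq, q2t_eq, termC_one_mul]
  · rw [M_eq, powU_eq, q2_eq, q1_eq]; push_cast; rfl

theorem isRationalForm_numM_denM : IsRationalForm numM denM := by
  intro f
  have h1 := one_lt_q1 f
  have h2 := one_lt_q2 f (f ^ 2)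
  have h3 := powU_pos f
  constructor
  · unfold denM
    have h1' : q1 f - 1 ≠ 0 := by omega
    have h2' : q2 f (f ^ 2) - 1 ≠ 0 := by omega
    have h3' : powU f + 1 ≠ 0 := by omega
    exact mul_ne_zero (mul_ne_zero h3' (pow_ne_zero 5 h1')) (pow_ne_zero 3 h2')
  · obtain ⟨g₀₁, g₂₁, g₄₁, g₀₂, g₁₂, g₂₂, c, e1, e2, e3, e4, e5, e6, e7, e8⟩ :=
      exists_M_components f
    simp only [numM, denM]
    rw [e8, ← e1, ← e2, ← e3, ← e4, ← e5, ← e6]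
    linear_combination (q1 f - 1) ^ 5 * (q2 f (f ^ 2) - 1) ^ 3 * e7

/-! ### Single-fold behaviour of the relation for `M (4 f)`. -/

theorem EM4_nonneg (f₁ f₂ f₃ f₄ q₁₁ q₂₁ g₀₁ g₂₁ g₄₁ g₀₂ g₁₂ g₂₂ c m : ℕ) :
    0 ≤ EM4 f₁ f₂ f₃ f₄ q₁₁ q₂₁ g₀₁ g₂₁ g₄₁ g₀₂ g₁₂ g₂₂ c m := by
  unfold EM4; positivity

theorem natCast_eq_iff_of_mul_eq {a b : ℕ} {d N : ℤ} (hd : d ≠ 0) (hb : (b : ℤ) * d = N) :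
    (a : ℤ) * d = N ↔ a = b := by
  rw [← hb, mul_left_inj' hd, Nat.cast_inj]

theorem sum_ten_sq_eq_zero_iff (a b c d e f g h i j : ℤ) :
    a ^ 2 + b ^ 2 + c ^ 2 + d ^ 2 + e ^ 2 + f ^ 2 + g ^ 2 + h ^ 2 + i ^ 2 + j ^ 2 = 0 ↔
      ((((((((a = 0 ∧ b = 0) ∧ c = 0) ∧ d = 0) ∧ e = 0) ∧ f = 0) ∧ g = 0) ∧ h = 0) ∧ i = 0)
        ∧ j = 0 := by
  iterate 9 rw [add_eq_zero_iff_of_nonneg_int (by positivity) (by positivity)]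
  simp only [sq_eq_zero_iff]

/-- Each unknown is fixed by a linear equation with nonzero coefficient, and `exists_M_components`
supplies a natural number solving it. -/
theorem EM4_single_fold (f : ℕ) : ∃ W : Fin 9 → ℕ,
    ∀ q₁₁ q₂₁ g₀₁ g₂₁ g₄₁ g₀₂ g₁₂ g₂₂ c m : ℕ,
      EM4 f (f ^ 2) (f ^ 3) (4 * f + 1) q₁₁ q₂₁ g₀₁ g₂₁ g₄₁ g₀₂ g₁₂ g₂₂ c m = 0 ↔
      (m : ℤ) = M (4 * f) ∧ q₁₁ = W 0 ∧ q₂₁ = W 1 ∧ g₀₁ = W 2 ∧ g₂₁ = W 3 ∧ g₄₁ = W 4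
        ∧ g₀₂ = W 5 ∧ g₁₂ = W 6 ∧ g₂₂ = W 7 ∧ c = W 8 := by
  have h1 := one_lt_q1 f
  have h2 := one_lt_q2 f (f ^ 2)
  have h3 := powU_pos f
  obtain ⟨G₀₁, G₂₁, G₄₁, G₀₂, G₁₂, G₂₂, c', e1, e2, e3, e4, e5, e6, e7, e8⟩ :=
    exists_M_components f
  refine ⟨![(q1 f - 1).toNat, (q2 f (f ^ 2) - 1).toNat, G₀₁, G₂₁, G₄₁, G₀₂, G₁₂, G₂₂, c'], ?_⟩
  intro q₁₁ q₂₁ g₀₁ g₂₁ g₄₁ g₀₂ g₁₂ g₂₂ c m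
  have h1' : q1 f - 1 ≠ 0 := by omega
  have h2' : q2 f (f ^ 2) - 1 ≠ 0 := by omega
  have h3' : powU f + 1 ≠ 0 := by omega
  have c1 : (q₁₁ : ℤ) - q1 f + 1 = 0 ↔ q₁₁ = (q1 f - 1).toNat := by omega
  have c2 : (q₂₁ : ℤ) - q2 f (f ^ 2) + 1 = 0 ↔ q₂₁ = (q2 f (f ^ 2) - 1).toNat := by omega
  unfold EM4
  push_cast
  rw [sum_ten_sq_eq_zero_iff, c1, c2]
  simp only [sub_eq_zero]
  have hv1 : q₁₁ = (q1 f - 1).toNat → (q₁₁ : ℤ) = q1 f - 1 := by omega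
  have hv2 : q₂₁ = (q2 f (f ^ 2) - 1).toNat → (q₂₁ : ℤ) = q2 f (f ^ 2) - 1 := by omega
  have k1 := natCast_eq_iff_of_mul_eq (a := g₀₁) h1' e1
  have k2 := natCast_eq_iff_of_mul_eq (a := g₀₂) h2' e2
  have k3 := natCast_eq_iff_of_mul_eq (a := g₁₂) (pow_ne_zero 2 h2') e3
  have k4 := natCast_eq_iff_of_mul_eq (a := g₂₁) (pow_ne_zero 3 h1') e4
  have k5 := natCast_eq_iff_of_mul_eq (a := g₂₂) (pow_ne_zero 3 h2') e5
  have k6 := natCast_eq_iff_of_mul_eq (a := g₄₁) (pow_ne_zero 5 h1') e6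
  have k7 := natCast_eq_iff_of_mul_eq (a := c) h3' e7
  constructor
  · rintro ⟨⟨⟨⟨⟨⟨⟨⟨⟨a1, a2⟩, a3⟩, a4⟩, a5⟩, a6⟩, a7⟩, a8⟩, a9⟩, a10⟩
    rw [hv1 a1] at a3 a6 a8
    rw [hv2 a2] at a4 a5 a7
    obtain rfl := k1.1 a3
    obtain rfl := k2.1 a4
    obtain rfl := k3.1 a5
    obtain rfl := k4.1 a6
    obtain rfl := k5.1 a7
    obtain rfl := k6.1 a8
    obtain rfl := k7.1 a9
    refine ⟨?_, a1, a2, rfl, rfl, rfl, rfl, rfl, rfl, rfl⟩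
    rw [a10, e8]; ring
  · rintro ⟨a0, a1, a2, rfl, rfl, rfl, rfl, rfl, rfl, rfl⟩
    rw [hv1 a1, hv2 a2]
    refine ⟨⟨⟨⟨⟨⟨⟨⟨⟨a1, a2⟩, e1⟩, e2⟩, e3⟩, e4⟩, e5⟩, e6⟩, e7⟩, ?_⟩
    rw [a0, e8]; ring

/-! Hamming weights. -/

/-- The Hamming weight of `n`. -/
def hw (n : ℕ) : ℕ := (Nat.digits 2 n).sum

theorem hw_zero : hw 0 = 0 := rfl

theorem hw_eq_mod_add_div (n : ℕ) : hw n = n % 2 + hw (n / 2) := by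
  unfold hw
  rcases Nat.eq_zero_or_pos n with rfl | hn
  · rfl
  · rw [Nat.digits_def' (by norm_num) hn, List.sum_cons]

theorem hw_add_pow_mul {k a : ℕ} (ha : a < 2 ^ k) (b : ℕ) :
    hw (a + 2 ^ k * b) = hw a + hw b := by
  induction k generalizing a with
  | zero => obtain rfl : a = 0 := by simpa using ha
            simp [hw_zero]
  | succ k ih =>
    rw [hw_eq_mod_add_div, hw_eq_mod_add_div a, pow_succ', mul_assoc]
    rw [pow_succ'] at ha
    have h1 : (a + 2 * (2 ^ k * b)) % 2 = a % 2 := by omega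
    have h2 : (a + 2 * (2 ^ k * b)) / 2 = a / 2 + 2 ^ k * b := by omega
    rw [h1, h2, ih (by omega), add_assoc]

theorem hw_add_hw_compl {k a : ℕ} (ha : a < 2 ^ k) : hw a + hw (2 ^ k - 1 - a) = k := by
  induction k generalizing a with
  | zero => obtain rfl : a = 0 := by simpa using ha
            simp [hw_zero]
  | succ k ih =>
    rw [hw_eq_mod_add_div a, hw_eq_mod_add_div (2 ^ (k + 1) - 1 - a), pow_succ']
    rw [pow_succ'] at ha
    have h1 : (2 * 2 ^ k - 1 - a) / 2 = 2 ^ k - 1 - a / 2 := by omega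
    have := ih (a := a / 2) (by omega)
    rw [h1]
    omega

theorem hw_pow_sub_one (k : ℕ) : hw (2 ^ k - 1) = k := by
  simpa [hw_zero] using hw_add_hw_compl (k := k) (a := 0) (by positivity)

/-- The upper `u` bits are those of `w - 1` and the lower `u` bits are their complement, so the
weights add up to `u`. -/
theorem hw_pow_sub_one_mul {u w : ℕ} (hw₀ : 0 < w) (hwu : w ≤ 2 ^ u) :
    hw ((2 ^ u - 1) * w) = u := by
  have h : (2 ^ u - 1) * w = (2 ^ u - 1 - (w - 1)) + 2 ^ u * (w - 1) := by
    obtain ⟨v, rfl⟩ : ∃ v, w = v + 1 := ⟨w - 1, by omega⟩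
    obtain ⟨s, hs⟩ : ∃ s, 2 ^ u = v + 1 + s := ⟨2 ^ u - (v + 1), by omega⟩
    rw [hs, show v + 1 + s - 1 = v + s by omega, show v + s - (v + 1 - 1) = s by omega,
      Nat.add_sub_cancel]
    ring
  rw [h, hw_add_pow_mul (by omega), add_comm, hw_add_hw_compl (by omega)]

theorem sum_mul_pow_lt {Q : ℕ} (B : ℕ → ℕ) (hB : ∀ i, B i < Q) (T : ℕ) :
    ∑ i ∈ Finset.range T, B i * Q ^ i < Q ^ T := by
  induction T with
  | zero => simp
  | succ T ih =>
    rw [Finset.sum_range_succ, pow_succ]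
    nlinarith [Nat.mul_le_mul_right (Q ^ T) (Nat.succ_le_of_lt (hB T))]

theorem hw_sum_mul_pow {k : ℕ} (B : ℕ → ℕ) (hB : ∀ i, B i < 2 ^ k) (T : ℕ) :
    hw (∑ i ∈ Finset.range T, B i * (2 ^ k) ^ i) = ∑ i ∈ Finset.range T, hw (B i) := by
  induction T with
  | zero => simp [hw_zero]
  | succ T ih =>
    have h := sum_mul_pow_lt B hB T
    rw [Finset.sum_range_succ, Finset.sum_range_succ, ← ih, mul_comm (B T)]
    rw [← pow_mul] at h ⊢
    exact hw_add_pow_mul h _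

/-! The hypercube encoding of `(x₁ ^ 2 - n * x₂ - 1) ^ 2`. -/

/-- The encoded value at `(x₁, x₂)`. -/
def encodedValue (n x₁ x₂ : ℕ) : ℕ := ((x₁ : ℤ) ^ 2 - n * x₂ - 1).natAbs ^ 2

/-- This justifies `u = n + 5`: every encoded value is at most `2 ^ u`. -/
theorem sq_add_one_sq_le (n : ℕ) : (n ^ 2 + 1) ^ 2 ≤ 2 ^ (n + 5) := by
  rcases Nat.lt_or_ge n 8 with h | h
  · interval_cases n <;> norm_num
  · induction n, h using Nat.le_induction with
    | base => norm_num
    | succ n hn ih =>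
      rw [show n + 1 + 5 = n + 5 + 1 by ring, pow_succ 2 (n + 5)]
      -- The ratio `7 / 5` suffices because its square is below `2`.
      have h1 : ((n + 1) ^ 2 + 1) * 5 ≤ (n ^ 2 + 1) * 7 := by nlinarith
      have h2 := Nat.pow_le_pow_left h1 2
      rw [mul_pow, mul_pow] at h2
      omega

theorem encodedValue_le {n x₁ x₂ : ℕ} (h₁ : x₁ ≤ n) (h₂ : x₂ ≤ n) :
    encodedValue n x₁ x₂ ≤ 2 ^ (n + 5) := by
  refine le_trans ?_ (sq_add_one_sq_le n)
  unfold encodedValue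
  refine Nat.pow_le_pow_left ?_ 2
  have e1 : x₁ ^ 2 ≤ n ^ 2 := Nat.pow_le_pow_left h₁ 2
  have e2 : n * x₂ ≤ n ^ 2 := by rw [sq]; exact Nat.mul_le_mul_left n h₂
  zify at e1 e2
  have e3 : (0 : ℤ) ≤ (n : ℤ) * x₂ := by positivity
  have e4 : (0 : ℤ) ≤ (x₁ : ℤ) ^ 2 := by positivity
  zify
  rw [abs_le]
  constructor <;> linarith

theorem encodedValue_eq_zero_iff (n x₁ x₂ : ℕ) :
    encodedValue n x₁ x₂ = 0 ↔ x₁ ^ 2 = n * x₂ + 1 := by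
  unfold encodedValue
  rw [sq_eq_zero_iff, Int.natAbs_eq_zero]
  zify
  constructor <;> intro h <;> linarith

/-- The block of `2 * (n + 5)` binary digits of `M n` that encodes the value at `(x₁, x₂)`. -/
def block (n x₁ x₂ : ℕ) : ℕ := (2 ^ (n + 5) - 1) * (2 ^ (n + 5) + 1 - encodedValue n x₁ x₂)

theorem sub_one_mul_add_one_eq {a : ℕ} (ha : 0 < a) : (a - 1) * (a + 1) = a ^ 2 - 1 := by
  obtain ⟨s, rfl⟩ : ∃ s, a = s + 1 := ⟨a - 1, by omega⟩
  rw [Nat.add_sub_cancel, show (s + 1) ^ 2 = s * (s + 1 + 1) + 1 by ring, Nat.add_sub_cancel]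

theorem block_lt (n x₁ x₂ : ℕ) : block n x₁ x₂ < 2 ^ (2 * (n + 5)) := by
  have h : 0 < 2 ^ (n + 5) := by positivity
  unfold block
  calc (2 ^ (n + 5) - 1) * (2 ^ (n + 5) + 1 - encodedValue n x₁ x₂)
      ≤ (2 ^ (n + 5) - 1) * (2 ^ (n + 5) + 1) := Nat.mul_le_mul_left _ (Nat.sub_le _ _)
    _ < 2 ^ (2 * (n + 5)) := by
      rw [sub_one_mul_add_one_eq h, ← pow_mul, mul_comm]
      exact Nat.sub_lt (by positivity) one_pos

/-- With `u = n + 5`, value `0` gives `2 ^ (2u) - 1`, all ones. A value in `[1, 2 ^ u]` gives `2 ^ u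
- 1` times a factor in the same range, of weight `u`. -/
theorem hw_block {n x₁ x₂ : ℕ} (h₁ : x₁ ≤ n) (h₂ : x₂ ≤ n) :
    hw (block n x₁ x₂) = (n + 5) * (1 + if x₁ ^ 2 = n * x₂ + 1 then 1 else 0) := by
  have hle := encodedValue_le h₁ h₂
  unfold block
  split_ifs with h
  · rw [(encodedValue_eq_zero_iff ..).2 h]
    have h0 : 0 < 2 ^ (n + 5) := by positivity
    have h' : (2 ^ (n + 5) - 1) * (2 ^ (n + 5) + 1 - 0) = 2 ^ ((n + 5) * 2) - 1 := by
      rw [pow_mul, Nat.sub_zero, sub_one_mul_add_one_eq h0]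
    rw [h', hw_pow_sub_one]
  · rw [← encodedValue_eq_zero_iff] at h
    rw [hw_pow_sub_one_mul (by omega) (by omega)]; simp

/-- Expanding the square in each block into monomials `x₁ ^ i * x₂ ^ j` turns the double sum into
products of the progressions `G`. -/
theorem M_eq_sum_block (n : ℕ) : M n = ((∑ x₂ ∈ Finset.range (n + 1),
    (∑ x₁ ∈ Finset.range (n + 1), block n x₁ x₂ * (2 ^ (2 * (n + 5))) ^ x₁)
      * (2 ^ (2 * (n + 5) * (n + 1))) ^ x₂ : ℕ) : ℤ) := by
  rw [M_eq, termC_one_eq]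
  set q : ℤ := 2 ^ (2 * (n + 5)) with hq
  set r : ℤ := 2 ^ (2 * (n + 5) * (n + 1)) with hr
  set U : ℤ := 2 ^ (n + 5) with hU
  have hG : ∀ i j, G i q (n + 1) * G j r (n + 1) = ∑ x₂ ∈ Finset.range (n + 1),
      ∑ x₁ ∈ Finset.range (n + 1), ((x₁ : ℤ) ^ i * q ^ x₁) * ((x₂ : ℤ) ^ j * r ^ x₂) := by
    intro i j
    unfold G
    rw [Finset.sum_mul_sum, Finset.sum_comm]
  simp only [hG]
  push_cast
  simp only [Finset.mul_sum, Finset.sum_mul, ← Finset.sum_add_distrib, ← Finset.sum_sub_distrib]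
  refine Finset.sum_congr rfl fun x₂ h₂ => Finset.sum_congr rfl fun x₁ h₁ => ?_
  have hle := encodedValue_le (Nat.lt_succ_iff.1 (Finset.mem_range.1 h₁))
    (Nat.lt_succ_iff.1 (Finset.mem_range.1 h₂))
  have hb : (block n x₁ x₂ : ℤ) = (U - 1) * (U + 1 - ((x₁ : ℤ) ^ 2 - n * x₂ - 1) ^ 2) := by
    unfold block
    rw [Nat.cast_mul, Nat.cast_sub (Nat.one_le_pow _ _ (by norm_num)), Nat.cast_sub (by omega)]
    unfold encodedValue
    push_cast
    rw [sq_abs]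
  rw [hb]
  ring

/-- The number of solutions of `x₁ ^ 2 = n * x₂ + 1` in the square `[0, n] × [0, n]`. -/
def numZeros (n : ℕ) : ℕ :=
  ∑ x₂ ∈ Finset.range (n + 1), ∑ x₁ ∈ Finset.range (n + 1),
    if x₁ ^ 2 = n * x₂ + 1 then 1 else 0

theorem exists_eq_M_hw (n : ℕ) :
    ∃ m : ℕ, (m : ℤ) = M n ∧ hw m = (n + 5) * ((n + 1) ^ 2 + numZeros n) := by
  refine ⟨_, (M_eq_sum_block n).symm, ?_⟩
  have hlt : ∀ x₂, ∑ x₁ ∈ Finset.range (n + 1), block n x₁ x₂ * (2 ^ (2 * (n + 5))) ^ x₁ <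
      2 ^ (2 * (n + 5) * (n + 1)) := by
    intro x₂
    rw [pow_mul 2 (2 * (n + 5))]
    exact sum_mul_pow_lt _ (fun x₁ => block_lt n x₁ x₂) _
  rw [hw_sum_mul_pow _ hlt]
  calc _ = ∑ x₂ ∈ Finset.range (n + 1), ∑ x₁ ∈ Finset.range (n + 1),
        (n + 5) * (1 + if x₁ ^ 2 = n * x₂ + 1 then 1 else 0) := by
        refine Finset.sum_congr rfl fun x₂ h₂ => ?_
        rw [hw_sum_mul_pow _ fun x₁ => block_lt n x₁ x₂]
        exact Finset.sum_congr rfl fun x₁ h₁ => hw_block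
          (Nat.lt_succ_iff.1 (Finset.mem_range.1 h₁)) (Nat.lt_succ_iff.1 (Finset.mem_range.1 h₂))
    _ = _ := by
        simp only [← Finset.mul_sum, Finset.sum_add_distrib, numZeros]
        simp
        ring

/-! Square roots of unity modulo `N`. -/

/-- The number of square roots of `1` modulo `N`. -/
noncomputable def numSqrtOne (N : ℕ) : ℕ := Nat.card {x : ZMod N // x ^ 2 = 1}

theorem numSqrtOne_one : numSqrtOne 1 = 1 := by
  unfold numSqrtOne
  rw [Nat.card_eq_one_iff_unique]
  exact ⟨⟨fun a b => Subsingleton.elim _ _⟩, ⟨⟨1, by simp⟩⟩⟩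

theorem numSqrtOne_mul {m n : ℕ} (h : m.Coprime n) :
    numSqrtOne (m * n) = numSqrtOne m * numSqrtOne n := by
  unfold numSqrtOne
  rw [← Nat.card_prod]
  let e := ZMod.chineseRemainder h
  have he : ∀ x : ZMod (m * n), x ^ 2 = 1 ↔ (e x).1 ^ 2 = 1 ∧ (e x).2 ^ 2 = 1 := by
    intro x
    rw [← e.injective.eq_iff, map_pow, map_one, Prod.ext_iff]
    rfl
  exact Nat.card_congr ((e.toEquiv.subtypeEquiv he).trans
    (Equiv.subtypeProdEquivProd (p := fun a : ZMod m => a ^ 2 = 1)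
      (q := fun b : ZMod n => b ^ 2 = 1)))

/-- An odd prime cannot divide both `z - 1` and `z + 1`, so the whole power `p ^ k` divides one of
them. -/
theorem numSqrtOne_odd_prime_pow {p k : ℕ} (hp : p.Prime) (hp2 : p ≠ 2) (hk : k ≠ 0) :
    numSqrtOne (p ^ k) = 2 := by
  have h1 : (1 : ZMod (p ^ k)) ≠ -1 := by
    intro h
    have h2 : ((2 : ℕ) : ZMod (p ^ k)) = 0 := by
      push_cast; linear_combination h
    rw [ZMod.natCast_eq_zero_iff] at h2
    have h3 := (Nat.dvd_prime Nat.prime_two).1 ((dvd_pow_self p hk).trans h2)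
    have := hp.one_lt
    omega
  have hset : {x : ZMod (p ^ k) | x ^ 2 = 1} = {1, -1} := by
    ext x
    simp only [Set.mem_ofPred_eq, Set.mem_insert_iff, Set.mem_singleton_iff]
    constructor
    · intro hx
      obtain ⟨z, rfl⟩ := ZMod.intCast_surjective x
      have hd : ((p ^ k : ℕ) : ℤ) ∣ (z - 1) * (z + 1) := by
        rw [← ZMod.intCast_zmod_eq_zero_iff_dvd]
        push_cast at hx ⊢
        linear_combination hx
      push_cast at hd
      have hpp : Prime (p : ℤ) := Nat.prime_iff_prime_int.1 hp
      by_cases hz : (p : ℤ) ∣ z - 1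
      · left
        have hz' : ¬ (p : ℤ) ∣ z + 1 := by
          intro h
          have h4 : (p : ℤ) ∣ 2 := by
            have := dvd_sub h hz
            ring_nf at this
            exact this
          have h5 : p ∣ 2 := by exact_mod_cast h4
          have := (Nat.dvd_prime Nat.prime_two).1 h5
          have := hp.one_lt
          omega
        have h6 : ((p ^ k : ℕ) : ℤ) ∣ z - 1 := by
          push_cast
          exact hpp.pow_dvd_of_dvd_mul_right k hz' hd
        rw [← ZMod.intCast_zmod_eq_zero_iff_dvd] at h6
        push_cast at h6
        linear_combination h6
      · right
        have h6 : ((p ^ k : ℕ) : ℤ) ∣ z + 1 := by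
          push_cast
          exact hpp.pow_dvd_of_dvd_mul_left k hz hd
        rw [← ZMod.intCast_zmod_eq_zero_iff_dvd] at h6
        push_cast at h6
        linear_combination h6
    · rintro (rfl | rfl) <;> ring
  have : numSqrtOne (p ^ k) = {x : ZMod (p ^ k) | x ^ 2 = 1}.ncard := rfl
  rw [this, hset, Set.ncard_pair h1]

/-- A root is odd, `z = 2 y + 1`, and `2 ^ (k + 1)` divides one of the coprime factors `y`, `y + 1`.
The choice of factor and the parity of the cofactor give the four roots `±1` and `±1 + 2 ^ (k + 2)`.
-/
theorem numSqrtOne_two_pow (k : ℕ) : numSqrtOne (2 ^ (k + 3)) = 4 := by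
  have hcast : ∀ z : ℤ, (z : ZMod (2 ^ (k + 3))) = 0 ↔ (2 : ℤ) ^ (k + 3) ∣ z := by
    intro z
    rw [ZMod.intCast_zmod_eq_zero_iff_dvd]; push_cast; rfl
  have hs : (2 : ℤ) ^ (k + 3) = 8 * 2 ^ k := by ring
  have hpos : (0 : ℤ) < 2 ^ k := by positivity
  set h : ℤ := 2 ^ (k + 2) with hh
  have hh4 : h = 4 * 2 ^ k := by rw [hh]; ring
  have hset : {x : ZMod (2 ^ (k + 3)) | x ^ 2 = 1} =
      {((1 : ℤ) : ZMod (2 ^ (k + 3))), ((-1 : ℤ) : ZMod _), ((1 + h : ℤ) : ZMod _),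
        ((-1 + h : ℤ) : ZMod _)} := by
    ext x
    obtain ⟨z, rfl⟩ := ZMod.intCast_surjective x
    simp only [Set.mem_ofPred_eq, Set.mem_insert_iff, Set.mem_singleton_iff]
    have hsq : (z : ZMod (2 ^ (k + 3))) ^ 2 = 1 ↔ (2 : ℤ) ^ (k + 3) ∣ (z - 1) * (z + 1) := by
      rw [← hcast]; push_cast
      constructor <;> intro h <;> linear_combination h
    have heq : ∀ w : ℤ, (z : ZMod (2 ^ (k + 3))) = (w : ZMod _) ↔ (2 : ℤ) ^ (k + 3) ∣ z - w := by
      intro w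
      rw [← hcast, ← sub_eq_zero]; push_cast; rfl
    rw [hsq, heq, heq, heq, heq]
    constructor
    · intro hd
      obtain ⟨y, hy⟩ : ∃ y, z = 2 * y + 1 := by
        rcases Int.even_or_odd z with he | ho
        · exfalso
          have h1 : Odd ((z - 1) * (z + 1)) := (he.sub_odd odd_one).mul (he.add_odd odd_one)
          have h2 : (2 : ℤ) ∣ (z - 1) * (z + 1) := (dvd_pow_self 2 (by omega)).trans hd
          exact Int.not_even_iff_odd.2 h1 (even_iff_two_dvd.2 h2)
        · exact ho
      have hd' : (2 : ℤ) ^ (k + 1) ∣ y * (y + 1) := by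
        obtain ⟨c, hc⟩ := hd
        refine ⟨c, ?_⟩
        have : (4 : ℤ) * (y * (y + 1)) = 4 * (2 ^ (k + 1) * c) := by
          rw [hy] at hc
          linear_combination hc
        linarith
      have hcases : (2 : ℤ) ^ (k + 1) ∣ y ∨ (2 : ℤ) ^ (k + 1) ∣ y + 1 := by
        rcases Int.even_or_odd y with he | ho
        · left
          refine Int.prime_two.pow_dvd_of_dvd_mul_right _ ?_ hd'
          intro h
          exact Int.not_even_iff_odd.2 (he.add_odd odd_one) (even_iff_two_dvd.2 h)
        · right
          refine Int.prime_two.pow_dvd_of_dvd_mul_left _ ?_ hd'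
          intro h
          exact Int.not_even_iff_odd.2 ho (even_iff_two_dvd.2 h)
      rcases hcases with ⟨c, hc⟩ | ⟨c, hc⟩
      · obtain ⟨e, he | he⟩ := Int.even_or_odd' c
        · left; exact ⟨e, by rw [hy, hc, he]; ring⟩
        · right; right; left
          exact ⟨e, by rw [hy, hc, he, hh]; ring⟩
      · obtain ⟨e, he | he⟩ := Int.even_or_odd' c
        · right; left
          exact ⟨e, by rw [he] at hc; rw [hy]; linear_combination 2 * hc⟩
        · right; right; right
          exact ⟨e, by rw [he] at hc; rw [hy, hh]; linear_combination 2 * hc⟩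
    · rintro (⟨c, hc⟩ | ⟨c, hc⟩ | ⟨c, hc⟩ | ⟨c, hc⟩)
      · exact ⟨c * (z + 1), by rw [hc]; ring⟩
      · exact ⟨c * (z - 1), by linear_combination (z - 1) * hc⟩
      · obtain rfl : z = 1 + h + 2 ^ (k + 3) * c := by linarith
        exact ⟨(1 + 2 * c) * (1 + 2 ^ (k + 1) + 2 ^ (k + 2) * c), by rw [hh]; ring⟩
      · obtain rfl : z = -1 + h + 2 ^ (k + 3) * c := by linarith
        exact ⟨(1 + 2 * c) * (-1 + 2 ^ (k + 1) + 2 ^ (k + 2) * c), by rw [hh]; ring⟩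
  have hne : ∀ a b : ℤ, 0 < a - b → a - b < 2 ^ (k + 3) →
      (a : ZMod (2 ^ (k + 3))) ≠ (b : ZMod _) := by
    intro a b h1 h2 h3
    have h4 : (2 : ℤ) ^ (k + 3) ∣ a - b := by
      rw [← hcast]; push_cast; rw [h3, sub_self]
    exact absurd (Int.le_of_dvd h1 h4) (not_le.2 h2)
  have : numSqrtOne (2 ^ (k + 3)) = {x : ZMod (2 ^ (k + 3)) | x ^ 2 = 1}.ncard := rfl
  rw [this, hset, Set.ncard_insert_of_notMem, Set.ncard_insert_of_notMem, Set.ncard_pair]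
  · exact hne _ _ (by linarith) (by linarith)
  · simp only [Set.mem_insert_iff, Set.mem_singleton_iff, not_or]
    exact ⟨(hne _ _ (by linarith) (by linarith)).symm, (hne _ _ (by linarith) (by linarith)).symm⟩
  · simp only [Set.mem_insert_iff, Set.mem_singleton_iff, not_or]
    exact ⟨hne _ _ (by linarith) (by linarith), (hne _ _ (by linarith) (by linarith)).symm,
      (hne _ _ (by linarith) (by linarith)).symm⟩

theorem numSqrtOne_four : numSqrtOne 4 = 2 := by
  unfold numSqrtOne
  rw [Nat.card_eq_fintype_card]
  decide

/-- The factor `4` guarantees `8 ∣ 4 a!` once `a ≥ 2`. The prime `2` then contributes `4` and each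
odd prime up to `a` contributes `2`. For `a < 2` the modulus is `4`, with two roots, which fits the
same formula. -/
theorem numSqrtOne_four_mul_factorial (a : ℕ) :
    numSqrtOne (4 * a.factorial) = 2 ^ (Nat.count Nat.Prime (a + 1) + 1) := by
  rcases Nat.lt_or_ge a 2 with ha | ha
  · interval_cases a <;> simp [Nat.count_succ, numSqrtOne_four, Nat.not_prime_one,
      Nat.not_prime_zero]
  · set N := 4 * a.factorial with hN
    have hN0 : N ≠ 0 := by positivity
    have hpf : N.primeFactors = {q ∈ Finset.range (a + 1) | q.Prime} := by
      ext q
      rw [Nat.mem_primeFactors, Finset.mem_filter, Finset.mem_range]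
      constructor
      · rintro ⟨hq, hd, -⟩
        refine ⟨?_, hq⟩
        rcases hq.dvd_mul.1 hd with h | h
        · have : q ∣ 2 := hq.dvd_of_dvd_pow (n := 2) (m := 2) (by simpa using h)
          have := Nat.le_of_dvd (by norm_num) this
          omega
        · exact Nat.lt_succ_iff.2 (hq.dvd_factorial.1 h)
      · rintro ⟨h, hq⟩
        exact ⟨hq, dvd_mul_of_dvd_right (hq.dvd_factorial.2 (Nat.lt_succ_iff.1 h)) _, hN0⟩
    have h2mem : 2 ∈ N.primeFactors := by
      rw [hpf, Finset.mem_filter, Finset.mem_range]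
      exact ⟨by omega, Nat.prime_two⟩
    have hcard : Nat.count Nat.Prime (a + 1) = (N.primeFactors.erase 2).card + 1 := by
      rw [Finset.card_erase_add_one h2mem, hpf, Nat.count_eq_card_filter_range]
    have h8 : 2 ^ 3 ∣ N := by
      have : 2 ∣ a.factorial := Nat.dvd_factorial (by norm_num) ha
      rw [hN, show 2 ^ 3 = 4 * 2 by norm_num]
      exact mul_dvd_mul_left 4 this
    have h8' : 3 ≤ N.factorization 2 := (Nat.prime_two.pow_dvd_iff_le_factorization hN0).1 h8
    rw [Nat.multiplicative_factorization numSqrtOne (fun _ _ => numSqrtOne_mul) numSqrtOne_one hN0,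
      Finsupp.prod, Nat.support_factorization, ← Finset.mul_prod_erase _ _ h2mem]
    have e1 : numSqrtOne (2 ^ N.factorization 2) = 4 := by
      obtain ⟨k, hk⟩ : ∃ k, N.factorization 2 = k + 3 := ⟨_, (Nat.sub_add_cancel h8').symm⟩
      rw [hk, numSqrtOne_two_pow]
    have e2 : ∀ q ∈ N.primeFactors.erase 2, numSqrtOne (q ^ N.factorization q) = 2 := by
      intro q hq
      rw [Finset.mem_erase] at hq
      have hqp := Nat.prime_of_mem_primeFactors hq.2
      exact numSqrtOne_odd_prime_pow hqp hq.1
        (hqp.factorization_pos_of_dvd hN0 (Nat.dvd_of_mem_primeFactors hq.2)).ne'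
    rw [e1, Finset.prod_congr rfl e2, Finset.prod_const, hcard]
    ring

/-- For `x ≤ n` a root of `1` modulo `n` has exactly one cofactor `y`, and `n y < x² ≤ n²` keeps `y`
in range. -/
theorem numZeros_eq_numSqrtOne {n : ℕ} (hn : 2 ≤ n) : numZeros n = numSqrtOne n := by
  have : NeZero n := ⟨by omega⟩
  have h1 : ∀ x ≤ n, (x : ZMod n) ^ 2 = 1 ↔ ∃ y ∈ Finset.range (n + 1), x ^ 2 = n * y + 1 := by
    intro x hx
    constructor
    · intro h
      have hmod : x ^ 2 ≡ 1 [MOD n] := by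
        rw [← ZMod.natCast_eq_natCast_iff]; push_cast; exact h
      have hx1 : 1 ≤ x ^ 2 := by
        rcases Nat.eq_zero_or_pos x with rfl | hx0
        · exfalso
          have := hmod
          unfold Nat.ModEq at this
          rw [Nat.mod_eq_of_lt (by omega), Nat.mod_eq_of_lt (by omega)] at this
          omega
        · exact Nat.one_le_pow _ _ hx0
      obtain ⟨y, hy⟩ := (Nat.modEq_iff_dvd' hx1).1 hmod.symm
      refine ⟨y, ?_, by omega⟩
      have : n * y ≤ n * n := by
        rw [← hy]
        exact (Nat.sub_le _ _).trans (by rw [sq]; exact Nat.mul_le_mul hx hx)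
      exact Finset.mem_range.2 (Nat.lt_succ_iff.2 (Nat.le_of_mul_le_mul_left this (by omega)))
    · rintro ⟨y, -, hy⟩
      have := congrArg (Nat.cast : ℕ → ZMod n) hy
      push_cast at this
      rw [this]; simp
  have h2 : ∀ x ≤ n, (∑ y ∈ Finset.range (n + 1), if x ^ 2 = n * y + 1 then 1 else 0) =
      if (x : ZMod n) ^ 2 = 1 then 1 else 0 := by
    intro x hx
    split_ifs with h
    · obtain ⟨y, hy, hxy⟩ := (h1 x hx).1 h
      rw [Finset.sum_eq_single_of_mem y hy, if_pos hxy]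
      intro z _ hz
      rw [if_neg]
      intro hxz
      have : n * y = n * z := by omega
      exact hz (Nat.eq_of_mul_eq_mul_left (by omega) this).symm
    · refine Finset.sum_eq_zero fun y hy => if_neg fun hxy => h ((h1 x hx).2 ⟨y, hy, hxy⟩)
  unfold numZeros
  rw [Finset.sum_comm, Finset.sum_congr rfl fun x hx =>
    h2 x (Nat.lt_succ_iff.1 (Finset.mem_range.1 hx)), Finset.sum_range_succ]
  -- The range `[0, n]` meets the class of `0` twice; the extra endpoint is not a root because `n ≥
  -- 2`.
  have hn0 : ¬ ((n : ZMod n) ^ 2 = 1) := by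
    have : Fact (1 < n) := ⟨by omega⟩
    simp
  rw [if_neg hn0, add_zero, ← Finset.card_filter]
  unfold numSqrtOne
  rw [Nat.card_eq_fintype_card, Fintype.card_subtype]
  refine Finset.card_bij (fun x _ => (x : ZMod n)) ?_ ?_ ?_
  · intro x hx
    simpa using (Finset.mem_filter.1 hx).2
  · intro x hx y hy hxy
    have hx' := Finset.mem_range.1 (Finset.mem_filter.1 hx).1
    have hy' := Finset.mem_range.1 (Finset.mem_filter.1 hy).1
    rw [ZMod.natCast_eq_natCast_iff] at hxy
    exact Nat.ModEq.eq_of_lt_of_lt hxy hx' hy'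
  · intro b hb
    refine ⟨b.val, ?_, ZMod.natCast_zmod_val b⟩
    rw [Finset.mem_filter, Finset.mem_range, ZMod.natCast_zmod_val]
    exact ⟨ZMod.val_lt b, by simpa using hb⟩

theorem numZeros_four_mul_factorial (a : ℕ) :
    numZeros (4 * a.factorial) = 2 ^ (Nat.count Nat.Prime (a + 1) + 1) := by
  have := Nat.factorial_pos a
  rw [numZeros_eq_numSqrtOne (by omega), numSqrtOne_four_mul_factorial]

/-! ### Counting the solutions. -/

theorem count_prime_add_one_le_iff {n a : ℕ} (hn : 1 ≤ n) :
    Nat.count Nat.Prime (a + 1) + 1 ≤ n ↔ a < p n := by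
  have h : Nat.count Nat.Prime (a + 1) ≤ n - 1 ↔ a + 1 ≤ Nat.nth Nat.Prime (n - 1) :=
    Nat.count_le_iff_le_nth Nat.infinite_setOfPred_prime
  unfold p
  rw [← Nat.succ_le_iff, ← h]
  omega

/-- Coordinate `0` parametrises the solution set bijectively by `0, …, N - 1`. -/
theorem encard_eq_of_single_fold {k : ℕ} (S : Set (Fin (k + 1) → ℕ)) (N : ℕ)
    (W : ℕ → Fin (k + 1) → ℕ) (hW : ∀ v, v ∈ S ↔ v 0 < N ∧ v = W (v 0))
    (hW₀ : ∀ a, W a 0 = a) : S.encard = N := by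
  have hS : S = (fun a => W a) '' (Finset.range N : Set ℕ) := by
    ext v
    rw [hW]
    constructor
    · rintro ⟨h1, h2⟩
      exact ⟨v 0, by simpa using h1, h2.symm⟩
    · rintro ⟨a, ha, rfl⟩
      simp only [hW₀]
      exact ⟨by simpa using ha, trivial⟩
  have hinj : Function.Injective (fun a => W a) := by
    intro a b hab
    have := congrFun hab 0
    simpa [hW₀] using this
  rw [hS, hinj.encard_image, Set.encard_coe_eq_coe_finsetCard, Finset.card_range]

/-- The last summand of the equations determines `d`, and it is solvable only for `a < p n`. -/
theorem last_equation_iff {n a m b d : ℕ} (hn : 1 ≤ n) (hm : (m : ℤ) = M (4 * a.factorial))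
    (hb : b = hw m) :
    ((b : ℤ) + (4 * a.factorial + 5) * (-(4 * (a.factorial : ℤ) + 1) ^ 2 + d - 2 ^ n) = 0) ↔
      a < p n ∧ d = 2 ^ n - 2 ^ (Nat.count Nat.Prime (a + 1) + 1) := by
  obtain ⟨m', hm', hwm⟩ := exists_eq_M_hw (4 * a.factorial)
  obtain rfl : m' = m := by exact_mod_cast hm'.trans hm.symm
  rw [hb, hwm, numZeros_four_mul_factorial, ← count_prime_add_one_le_iff hn]
  set c := Nat.count Nat.Prime (a + 1) + 1
  have h5 : (4 * (a.factorial : ℤ) + 5) ≠ 0 := by positivity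
  have key : (((4 * a.factorial + 5) * ((4 * a.factorial + 1) ^ 2 + 2 ^ c) : ℕ) : ℤ)
      + (4 * a.factorial + 5) * (-(4 * (a.factorial : ℤ) + 1) ^ 2 + d - 2 ^ n) =
      (4 * a.factorial + 5) * ((d : ℤ) + 2 ^ c - 2 ^ n) := by
    push_cast; ring
  rw [key, mul_eq_zero, or_iff_right h5, ← Nat.pow_le_pow_iff_right (a := 2) (by norm_num)]
  have e : (d : ℤ) + 2 ^ c - 2 ^ n = 0 ↔ d + 2 ^ c = 2 ^ n := by
    zify; constructor <;> intro h <;> linarith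
  rw [e]
  omega

theorem add_sq_eq_zero_iff {s a : ℤ} (hs : 0 ≤ s) : s + a ^ 2 = 0 ↔ s = 0 ∧ a = 0 := by
  rw [add_eq_zero_iff_of_nonneg_int hs (sq_nonneg a), sq_eq_zero_iff]

theorem add_sq_nonneg {s : ℤ} (hs : 0 ≤ s) (a : ℤ) : 0 ≤ s + a ^ 2 :=
  add_nonneg hs (sq_nonneg a)

theorem encard_Fhat {n : ℕ} (hn : 1 ≤ n) : {v : Fin 42 → ℕ | Fhat n v = 0}.encard = p n := by
  choose A hA using EFact_single_fold
  choose B hB using EM4_single_fold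
  choose C hC using EHW_single_fold
  refine encard_eq_of_single_fold _ (p n) (fun a =>
    let f := a.factorial
    let m := (M (4 * f)).toNat
    ![a, f, f ^ 2, f ^ 3, 4 * f + 1, m, hw m, 2 ^ n - 2 ^ (Nat.count Nat.Prime (a + 1) + 1),
      A a 0, A a 1, A a 2, A a 3, A a 4, A a 5, A a 6, A a 7, A a 8, A a 9, A a 10, A a 11,
      A a 12, B f 0, B f 1, B f 2, B f 3, B f 4, B f 5, B f 6, B f 7, B f 8,
      C m 0, C m 1, C m 2, C m 3, C m 4, C m 5, C m 6, C m 7, C m 8, C m 9, C m 10, C m 11])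
    ?_ (fun a => rfl)
  intro v
  rw [Set.mem_ofPred_eq]
  simp only [Fhat]
  have h1 := EFact_nonneg (v 0) (v 8) (v 9) (v 10) (v 11) (v 12) (v 13) (v 14) (v 15)
    (v 16) (v 17) (v 18) (v 19) (v 20) (v 1)
  have h2 := EM4_nonneg (v 1) (v 2) (v 3) (v 4) (v 21) (v 22) (v 23) (v 24) (v 25) (v 26) (v 27)
    (v 28) (v 29) (v 5)
  have h3 := EHW_nonneg (v 5) (v 30) (v 31) (v 32) (v 33) (v 34) (v 35) (v 36) (v 37) (v 38)
    (v 39) (v 40) (v 41) (v 6)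
  have h4 := fun x y z : ℤ => add_sq_nonneg (add_sq_nonneg (add_sq_nonneg h1 x) y) z
  rw [add_sq_eq_zero_iff (add_nonneg (add_nonneg (h4 _ _ _) h2) h3),
    add_eq_zero_iff_of_nonneg_int (add_nonneg (h4 _ _ _) h2) h3,
    add_eq_zero_iff_of_nonneg_int (h4 _ _ _) h2,
    add_sq_eq_zero_iff (add_sq_nonneg (add_sq_nonneg h1 _) _),
    add_sq_eq_zero_iff (add_sq_nonneg h1 _), add_sq_eq_zero_iff h1, hA, hC]
  constructor
  · rintro ⟨⟨⟨⟨⟨⟨⟨e1, a0, a1, a2, a3, a4, a5, a6, a7, a8, a9, a10, a11, a12⟩, e2⟩, e3⟩, e4⟩, e5⟩,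
      e6, c0, c1, c2, c3, c4, c5, c6, c7, c8, c9, c10, c11⟩, e7⟩
    replace e2 : v 2 = v 1 ^ 2 := by zify; linarith
    replace e3 : v 3 = v 1 ^ 3 := by
      rw [e2] at e3; zify; push_cast at e3; linear_combination e3
    replace e4 : v 4 = 4 * v 1 + 1 := by omega
    -- The uniqueness statement for `EM4` requires `f₂`, `f₃`, `f₄` to be specialised first.
    rw [e2, e3, e4, hB] at e5
    obtain ⟨hm, b0, b1, b2, b3, b4, b5, b6, b7, b8⟩ := e5
    rw [e4] at e7
    rw [e1] at e2 e3 e4 e7 hm b0 b1 b2 b3 b4 b5 b6 b7 b8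
    push_cast at e7
    obtain ⟨hlt, hd⟩ := (last_equation_iff hn hm e6).1 e7
    refine ⟨hlt, ?_⟩
    have hm' : v 5 = (M (4 * (v 0).factorial)).toNat := by omega
    rw [hm'] at e6 c0 c1 c2 c3 c4 c5 c6 c7 c8 c9 c10 c11
    funext i
    fin_cases i
    · rfl
    all_goals assumption
  · rintro ⟨hlt, h⟩
    have g := congrFun h
    have e1 : v 1 = (v 0).factorial := g 1
    have e2 : v 2 = (v 0).factorial ^ 2 := g 2
    have e3 : v 3 = (v 0).factorial ^ 3 := g 3
    have e4 : v 4 = 4 * (v 0).factorial + 1 := g 4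
    have e5 : v 5 = (M (4 * (v 0).factorial)).toNat := g 5
    have e6 : v 6 = hw (M (4 * (v 0).factorial)).toNat := g 6
    have hm : (v 5 : ℤ) = M (4 * (v 0).factorial) := by
      obtain ⟨m, hm, -⟩ := exists_eq_M_hw (4 * (v 0).factorial)
      rw [e5, ← hm, Int.toNat_natCast]
    have e7 := (last_equation_iff hn hm (e6.trans (by rw [e5]))).2 ⟨hlt, g 7⟩
    rw [e1, e2, e3, e4, hB, e5]
    refine ⟨⟨⟨⟨⟨⟨⟨rfl, g 8, g 9, g 10, g 11, g 12, g 13, g 14, g 15, g 16, g 17, g 18, g 19, g 20⟩,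
      ?_⟩, ?_⟩, ?_⟩, ?_, g 21, g 22, g 23, g 24, g 25, g 26, g 27, g 28, g 29⟩,
      e6, g 30, g 31, g 32, g 33, g 34, g 35, g 36, g 37, g 38, g 39, g 40, g 41⟩, ?_⟩
    · push_cast; ring
    · push_cast; ring
    · push_cast; ring
    · rw [← e5]; exact hm
    · push_cast; exact e7

theorem encard_F {L D : ℕ → ℕ → ℕ → ℤ} (hLD : IsRationalForm L D) {n : ℕ} (hn : 1 ≤ n) :
    {v : Fin 32 → ℕ | F L D n v = 0}.encard = p n := by
  choose A hA using EFact_single_fold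
  choose C hC using EHW_single_fold
  refine encard_eq_of_single_fold _ (p n) (fun a =>
    let f := a.factorial
    let m := (M (4 * f)).toNat
    ![a, f, f ^ 2, f ^ 3, m, hw m, 2 ^ n - 2 ^ (Nat.count Nat.Prime (a + 1) + 1),
      A a 0, A a 1, A a 2, A a 3, A a 4, A a 5, A a 6, A a 7, A a 8, A a 9, A a 10, A a 11,
      A a 12, C m 0, C m 1, C m 2, C m 3, C m 4, C m 5, C m 6, C m 7, C m 8, C m 9, C m 10,
      C m 11])
    ?_ (fun a => rfl)
  intro v
  rw [Set.mem_ofPred_eq]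
  simp only [F]
  have h1 := EFact_nonneg (v 0) (v 7) (v 8) (v 9) (v 10) (v 11) (v 12) (v 13) (v 14) (v 15)
    (v 16) (v 17) (v 18) (v 19) (v 1)
  have h3 := EHW_nonneg (v 4) (v 20) (v 21) (v 22) (v 23) (v 24) (v 25) (v 26) (v 27) (v 28)
    (v 29) (v 30) (v 31) (v 5)
  have h4 := fun x y z : ℤ => add_sq_nonneg (add_sq_nonneg (add_sq_nonneg h1 x) y) z
  rw [add_sq_eq_zero_iff (add_nonneg (h4 _ _ _) h3),
    add_eq_zero_iff_of_nonneg_int (h4 _ _ _) h3,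
    add_sq_eq_zero_iff (add_sq_nonneg (add_sq_nonneg h1 _) _),
    add_sq_eq_zero_iff (add_sq_nonneg h1 _), add_sq_eq_zero_iff h1, hA, hC]
  obtain ⟨hD, hL⟩ := hLD (v 0).factorial
  constructor
  · rintro ⟨⟨⟨⟨⟨⟨e1, a0, a1, a2, a3, a4, a5, a6, a7, a8, a9, a10, a11, a12⟩, e2⟩, e3⟩, e5⟩,
      e6, c0, c1, c2, c3, c4, c5, c6, c7, c8, c9, c10, c11⟩, e7⟩
    replace e2 : v 2 = v 1 ^ 2 := by zify; linarith
    replace e3 : v 3 = v 1 ^ 3 := by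
      rw [e2] at e3; zify; push_cast at e3; linear_combination e3
    rw [e1] at e2 e3 e7
    rw [e1, e2, e3, ← hL, sub_eq_zero] at e5
    -- Only here does the choice of `L` and `D` enter: the other squares force the arguments `(f,
    -- f², f³)`, where `D` is nonzero.
    have hm := mul_right_cancel₀ hD e5
    obtain ⟨hlt, hd⟩ := (last_equation_iff hn hm e6).1 e7
    refine ⟨hlt, ?_⟩
    have hm' : v 4 = (M (4 * (v 0).factorial)).toNat := by omega
    rw [hm'] at e6 c0 c1 c2 c3 c4 c5 c6 c7 c8 c9 c10 c11
    funext i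
    fin_cases i
    · rfl
    all_goals assumption
  · rintro ⟨hlt, h⟩
    have g := congrFun h
    have e1 : v 1 = (v 0).factorial := g 1
    have e2 : v 2 = (v 0).factorial ^ 2 := g 2
    have e3 : v 3 = (v 0).factorial ^ 3 := g 3
    have e5 : v 4 = (M (4 * (v 0).factorial)).toNat := g 4
    have e6 : v 5 = hw (M (4 * (v 0).factorial)).toNat := g 5
    have hm : (v 4 : ℤ) = M (4 * (v 0).factorial) := by
      obtain ⟨m, hm, -⟩ := exists_eq_M_hw (4 * (v 0).factorial)
      rw [e5, ← hm, Int.toNat_natCast]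
    have e7 := (last_equation_iff hn hm (e6.trans (by rw [e5]))).2 ⟨hlt, g 6⟩
    rw [e1, e2, e3, hm, hL, sub_self, e5]
    refine ⟨⟨⟨⟨⟨⟨rfl, g 7, g 8, g 9, g 10, g 11, g 12, g 13, g 14, g 15, g 16, g 17, g 18, g 19⟩,
      ?_⟩, ?_⟩, rfl⟩,
      e6, g 20, g 21, g 22, g 23, g 24, g 25, g 26, g 27, g 28, g 29, g 30, g 31⟩, e7⟩
    · push_cast; ring
    · push_cast; ring

end NthPrimeEq

theorem mainTheorem2 :
    (∀ n : ℕ, 1 ≤ n →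
      {v : Fin 42 → ℕ | NthPrimeEq.Fhat n v = 0}.encard = (NthPrimeEq.p n : ℕ∞)) ∧
    (∀ n : ℕ, 1 ≤ n →
      {v : Fin 32 → ℕ | NthPrimeEq.F NthPrimeEq.numM NthPrimeEq.denM n v = 0}.encard
        = (NthPrimeEq.p n : ℕ∞)) ∧
    NthPrimeEq.IsRationalForm NthPrimeEq.numM NthPrimeEq.denM ∧
    (∀ L D : ℕ → ℕ → ℕ → ℤ, NthPrimeEq.IsRationalForm L D → ∀ n : ℕ, 1 ≤ n →
      {v : Fin 32 → ℕ | NthPrimeEq.F L D n v = 0}.encard = (NthPrimeEq.p n : ℕ∞)) :=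
  ⟨fun _ hn => NthPrimeEq.encard_Fhat hn,
    fun _ hn => NthPrimeEq.encard_F NthPrimeEq.isRationalForm_numM_denM hn,
    NthPrimeEq.isRationalForm_numM_denM,
    fun _ _ hLD _ hn => NthPrimeEq.encard_F hLD hn⟩
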